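/- Let $n,k$ be integers with $1\le k\le n-2$, let $a>0$, and let $X$ be exponentially distributed with parameter $1$. **Algorithm.** For $z\ge 0$ let $F(\cdot\,;z)$ be the distribution function of $\mathcal L(X\mid X>z)$, with inverse $F(\cdot\,;z)^{-1}(u)=\inf\{y\in\mathbb R: u\le F(y;z)\}$. Let $x\in[0,a]$. Let $X^0_1,\dots,X^0_n$ be i.i.d. with law $\mathcal L(X\mid X>x)$, and let $(U^j_\ell)_{1\le \ell\le k,\ j\ge 1}$ be i.i.d. uniform on $(0,1)$ and independent of $(X^0_i)_i$. Put $Z^0=x$ and, for $j\ge 0$, let $Z^{j+1}=X^{j}_{(k)}$ be the $k$-th smallest of the values $X_1^{j},\dots,X_n^{j}$ and $\sigma^{j+1}$ the (almost surely unique) permutation with $X^{j}_{\sigma^{j+1}(1)}<\dots<X^{j}_{\sigma^{j+1}(n)}$. For $j\ge 1$ put $X_i^{j}=F(\cdot\,;Z^j)^{-1}(U^j_\ell)$ if $\ell=(\sigma^j)^{-1}(i)\le k$, and $X_i^j=X_i^{j-1}$ otherwise. The number of iterations is $J^{n,k}(x)=\min\{j\ge 0: Z^{j+1}\ge a\}$,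 and $$\hat p^{n,k}(x)=\frac1n\,\mathrm{Card}\bigl\{i: X_i^{J^{n,k}(x)}\ge a\bigr\}\Bigl(1-\frac kn\Bigr)^{J^{n,k}(x)}.$$ Put $p^{n,k}(x)=\mathbb E[\hat p^{n,k}(x)]$, $v^{n,k}(x)=\mathbb E[\hat p^{n,k}(x)^2]$ and $T^{n,k}(x)=\mathbb E[J^{n,k}(x)]+1$. **Coefficients.** Define, for $0\le l\le k-1$, $$\mu_0^{n,k}=1,\qquad \mu_{l+1}^{n,k}=-(n-k+l+1)\,\mu_l^{n,k},$$ $$r_{0,1}^{n,k}=n-k+1,\qquad r_{0,l+1}^{n,k}=-(n-k+l+1)\,r_{0,l}^{n,k}\quad (l\ge1),$$ $$r_{m,l+1}^{n,k}=r_{m-1,l}^{n,k}-(n-k+l+1)\,r_{m,l}^{n,k}\quad(1\le m\le l-1),\qquad r_{l,l+1}^{n,k}=r_{l-1,l}^{n,k}+(n-k+l+1)\quad(l\ge1),$$ and set $\mu^{n,k}=\mu_k^{n,k}$ and $r_m^{n,k}=r_{m,k}^{n,k}$ for $0\le m\le k-1$; these numbers depend only on $n$ and $k$. **Claim.** For every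 $x\in[0,a]$, the algorithm stops almost surely ($J^{n,k}(x)<\infty$) and $\hat p^{n,k}(x)$, $\hat p^{n,k}(x)^2$ and $J^{n,k}(x)$ are integrable. The functions $p^{n,k},v^{n,k},T^{n,k}$ are of class $C^k$ on $[0,a]$ (with one-sided derivatives at the endpoints) and satisfy, for all $x\in[0,a]$, $$\frac{d^k}{dx^k}p^{n,k}(x)=\Bigl(1-\frac kn\Bigr)\mu^{n,k}p^{n,k}(x)+\sum_{m=0}^{k-1}r_m^{n,k}\frac{d^m}{dx^m}p^{n,k}(x),$$ $$\frac{d^k}{dx^k}v^{n,k}(x)=\Bigl(1-\frac kn\Bigr)^2\mu^{n,k}v^{n,k}(x)+\sum_{m=0}^{k-1}r_m^{n,k}\frac{d^m}{dx^m}v^{n,k}(x),$$ $$\frac{d^k}{dx^k}T^{n,k}(x)=\sum_{m=1}^{k-1}r_m^{n,k}\frac{d^m}{dx^m}T^{n,k}(x)+\mu^{n,k}.$$ Moreover, for $m\in\{0,\dots,k-1\}$, $$\frac{d^m}{dx^m}p^{n,k}(x)\Big|_{x=a}=1,\qquad \frac{d^m}{dx^m}v^{n,k}(x)\Big|_{x=a}=\frac1n+\Bigl(1-\frac1n\Bigr)2^m,\qquad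 \frac{d^m}{dx^m}T^{n,k}(x)\Big|_{x=a}=\mathbf 1_{m=0}.$$ -/

import Mathlib

open MeasureTheory ProbabilityTheory Set

namespace AMS

/-- The `k`-th order statistic `Y_(k)` of the sample `Y`, for `1 ≤ k ≤ n`, read off from a permutation
sorting the sample in increasing order. Indices in `Fin n` start at `0`, hence the shift. -/
noncomputable def orderStat {n : ℕ} (Y : Fin n → ℝ) (k : ℕ) : ℝ :=
  if h : k - 1 < n then Y (Tuple.sort Y ⟨k - 1, h⟩) else 0

/-- The distribution function `F(y; z)` of the conditional law `𝓛(X | X > z)`, where `ν` is the law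
of `X`. -/
noncomputable def condCDF (ν : Measure ℝ) (z y : ℝ) : ℝ :=
  (ProbabilityTheory.cond ν (Ioi z)).real (Iic y)

/-- The inverse distribution function `F(·; z)⁻¹` of the conditional law `𝓛(X | X > z)`. -/
noncomputable def condQuantile (ν : Measure ℝ) (z u : ℝ) : ℝ :=
  sInf {y : ℝ | u ≤ condCDF ν z y}

/-- One resampling step. With `σ` the permutation sorting `Y` and `z = Y_(k)`, the particle of
rank `ℓ ≤ k` is replaced by `χ_ℓ = F(·; z)⁻¹(u_ℓ)`, and the others are kept. -/
noncomputable def resample (ν : Measure ℝ) {n k : ℕ} (Y : Fin n → ℝ) (u : Fin k → ℝ) :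
    Fin n → ℝ := fun i =>
  if h : ((Tuple.sort Y).symm i : ℕ) < k then
    condQuantile ν (orderStat Y k) (u ⟨(Tuple.sort Y).symm i, h⟩)
  else Y i

/-- The particles `(X_i^j)_i` at iteration `j`, computed from the initial sample `X⁰` and from the
numbers `u j ℓ`; those used at iteration `j + 1` are `u j`. -/
noncomputable def particles (ν : Measure ℝ) {n k : ℕ} (X₀ : Fin n → ℝ) (u : ℕ → Fin k → ℝ) :
    ℕ → Fin n → ℝ
  | 0 => X₀
  | j + 1 => resample ν (particles ν X₀ u j) (u j)

/-- The levels: `Z^0 = x` and `Z^(j+1)` is the `k`-th order statistic of the particles `X^j`. -/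
noncomputable def level (ν : Measure ℝ) {n k : ℕ} (x : ℝ) (X₀ : Fin n → ℝ)
    (u : ℕ → Fin k → ℝ) : ℕ → ℝ
  | 0 => x
  | j + 1 => orderStat (particles ν X₀ u j) k

/-- The number `J` of iterations: the least `j` with `Z^(j+1) ≥ a`
(by convention `0` if the algorithm does not stop). -/
noncomputable def iterations (ν : Measure ℝ) {n k : ℕ} (a x : ℝ) (X₀ : Fin n → ℝ)
    (u : ℕ → Fin k → ℝ) : ℕ :=
  sInf {j : ℕ | a ≤ level ν x X₀ u (j + 1)}

/-- The correction factor `C`: the proportion of final particles that lie at or above `a`. -/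
noncomputable def corrector (ν : Measure ℝ) {n k : ℕ} (a x : ℝ) (X₀ : Fin n → ℝ)
    (u : ℕ → Fin k → ℝ) : ℝ :=
  (1 / (n : ℝ)) * ({i : Fin n | a ≤ particles ν X₀ u (iterations ν a x X₀ u) i}.ncard : ℝ)

/-- The estimator `C (1 - k/n)^J`. -/
noncomputable def estimator (ν : Measure ℝ) {n k : ℕ} (a x : ℝ) (X₀ : Fin n → ℝ)
    (u : ℕ → Fin k → ℝ) : ℝ :=
  corrector ν a x X₀ u * (1 - (k : ℝ) / n) ^ iterations ν a x X₀ u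

/-- The random inputs of the algorithm started at `x`: an `n`-sample `ξ` of the law
`𝓛(X | X > x)`, and variables `U j ℓ` uniform on `(0, 1)`, all of these being independent. -/
structure IsInput {Ω : Type*} [MeasurableSpace Ω] (P : Measure Ω) (ν : Measure ℝ) {n k : ℕ}
    (x : ℝ) (ξ : Fin n → Ω → ℝ) (U : ℕ → Fin k → Ω → ℝ) : Prop where
  law_init : ∀ i, HasLaw (ξ i) (ProbabilityTheory.cond ν (Ioi x)) P
  law_unif : ∀ j l, HasLaw (U j l) (volume.restrict (Ioo (0 : ℝ) 1)) P
  indep : iIndepFun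
    (Sum.elim ξ (fun q : ℕ × Fin k => U q.1 q.2) : Fin n ⊕ (ℕ × Fin k) → Ω → ℝ) P

section Functions

variable {Ω : Type*} [MeasurableSpace Ω] (P : Measure Ω) (ν : Measure ℝ) {n k : ℕ} (a : ℝ)
  (ξ : ℝ → Fin n → Ω → ℝ) (U : ℝ → ℕ → Fin k → Ω → ℝ)

/-- The random variable `J^{n,k}(x)`, for the algorithm started at `x` with inputs `ξ x`, `U x`. -/
noncomputable def J (x : ℝ) (ω : Ω) : ℕ :=
  iterations ν a x (fun i => ξ x i ω) (fun j l => U x j l ω)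

/-- The random estimator `p̂^{n,k}(x)`. -/
noncomputable def pHat (x : ℝ) (ω : Ω) : ℝ :=
  estimator ν a x (fun i => ξ x i ω) (fun j l => U x j l ω)

/-- `p^{n,k}(x) = 𝔼[p̂^{n,k}(x)]`. -/
noncomputable def pFun (x : ℝ) : ℝ := ∫ ω, pHat ν a ξ U x ω ∂P

/-- `v^{n,k}(x) = 𝔼[p̂^{n,k}(x)²]`. -/
noncomputable def vFun (x : ℝ) : ℝ := ∫ ω, (pHat ν a ξ U x ω) ^ 2 ∂P

/-- `T^{n,k}(x) = 𝔼[J^{n,k}(x)] + 1`. -/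
noncomputable def TFun (x : ℝ) : ℝ := (∫ ω, (J ν a ξ U x ω : ℝ) ∂P) + 1

end Functions

/-- `μ_l^{n,k}`: `μ_0 = 1` and `μ_{l+1} = -(n-k+l+1) μ_l`. -/
noncomputable def muRec (n k : ℕ) : ℕ → ℝ
  | 0 => 1
  | l + 1 => -((n : ℝ) - k + l + 1) * muRec n k l

/-- `rRec n k l m` is `r_{m,l}^{n,k}`, meaningful for `m < l` (and `0` otherwise):
`r_{0,1} = n-k+1`; `r_{0,l+1} = -(n-k+l+1) r_{0,l}` for `l > 0`;
`r_{m,l+1} = r_{m-1,l} - (n-k+l+1) r_{m,l}` for `1 ≤ m ≤ l-1`;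
`r_{l,l+1} = r_{l-1,l} + (n-k+l+1)` for `l ≥ 1`. -/
noncomputable def rRec (n k : ℕ) : ℕ → ℕ → ℝ
  | 0, _ => 0
  | l + 1, 0 =>
      if l = 0 then (n : ℝ) - k + l + 1 else -((n : ℝ) - k + l + 1) * rRec n k l 0
  | l + 1, m + 1 =>
      if m + 1 < l then rRec n k l m - ((n : ℝ) - k + l + 1) * rRec n k l (m + 1)
      else if m + 1 = l then rRec n k l m + ((n : ℝ) - k + l + 1)
      else 0

/-- The coefficient `μ^{n,k} = μ_k^{n,k}`. -/
noncomputable def mu (n k : ℕ) : ℝ := muRec n k k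

/-- The coefficient `r_m^{n,k} = r_{m,k}^{n,k}`. -/
noncomputable def r (n k m : ℕ) : ℝ := rRec n k k m

end AMS

namespace AMS

open scoped ENNReal Polynomial

/-! The exponential law is memoryless, so conditioning on `X > z` is a shift by `z`, and the state
of the algorithm is best described by the current level and the excesses of the particles over it.
If the excesses form an i.i.d. exponential sample, then after one step the level increment is their
`k`-th order statistic, and the new excesses are again i.i.d. exponential and independent of this
increment (`map_orderStat_residual`). By induction the levels form a random walk with step law
`stepLaw n k`, and at each time the excesses are a fresh exponential sample independent of the level
(`map_excessChain`).

Almost surely `J + 1` counts the levels that are at most `a`, and the `s`-th power of the estimator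
is a series in `j` whose only nonzero term can be that of the step crossing `a` (`ae_eq_tsum`).
Taking expectations gives renewal series `∑ ρ^j L^j g` with `g(y) = Q(e^{y-a})` cut off above `a`:
`Q = 1`, `ρ = 1` for `T`, and `Q` a truncated binomial moment, `ρ = (1 - k/n)^s`, for `p` and `v`.
The series converges because the Laplace transform of the step law at `1` is less than `1`. Hence
each function solves a Volterra equation `f(x) = ρ ∫_x^a S(e^{x-y}) f(y) dy + Q(e^{x-a})`, where `S`
is the polynomial `stepPoly n k` (`renewalSum_toReal_eq`).

Differentiation in `x` acts on polynomials in `e^x` as `θ = X d/dX`. The kernel vanishes to order `k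
- 1` on the diagonal, so a boundary term appears only in the `k`-th derivative, where it gives `ρ μ
f` (`volterra_derivatives`). The exponents of `S` lie in `{n-k+1, …, n}`, so `∏ (θ - i)` over this
range annihilates `S`; its expansion is `θ^k - ∑ r_m θ^m` (`pow_sub_sum_rRec`), which yields the
differential equations. At `x = a` the integrals vanish, leaving the derivatives of the source at
`1`. -/

instance isProbabilityMeasure_expMeasure_one : IsProbabilityMeasure (expMeasure 1) :=
  isProbabilityMeasure_expMeasure one_pos

instance isProbabilityMeasure_uniform :
    IsProbabilityMeasure (volume.restrict (Ioo (0 : ℝ) 1)) :=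
  ⟨by simp⟩

/-! ### The exponential law, memorylessness and inverse transform sampling. -/

lemma expMeasure_real_Iic (z : ℝ) :
    (expMeasure 1).real (Iic z) = if 0 ≤ z then 1 - Real.exp (-z) else 0 := by
  rw [← cdf_eq_real, cdf_expMeasure_eq one_pos]; simp

lemma expMeasure_Iic {z : ℝ} (hz : 0 ≤ z) :
    expMeasure 1 (Iic z) = ENNReal.ofReal (1 - Real.exp (-z)) := by
  rw [← ofReal_measureReal, expMeasure_real_Iic, if_pos hz]

lemma expMeasure_real_Ioi {z : ℝ} (hz : 0 ≤ z) :
    (expMeasure 1).real (Ioi z) = Real.exp (-z) := by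
  rw [← compl_Iic, probReal_compl_eq_one_sub measurableSet_Iic, expMeasure_real_Iic, if_pos hz]
  ring

lemma expMeasure_Ioi {z : ℝ} (hz : 0 ≤ z) :
    expMeasure 1 (Ioi z) = ENNReal.ofReal (Real.exp (-z)) := by
  rw [← ofReal_measureReal, expMeasure_real_Ioi hz]

lemma condCDF_expMeasure {z : ℝ} (hz : 0 ≤ z) (y : ℝ) :
    condCDF (expMeasure 1) z y = if z ≤ y then 1 - Real.exp (-(y - z)) else 0 := by
  have hpos := Real.exp_pos (-z)
  rw [condCDF, measureReal_def, cond_apply measurableSet_Ioi, ENNReal.toReal_mul,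
    ENNReal.toReal_inv, ← measureReal_def, ← measureReal_def, expMeasure_real_Ioi hz]
  split_ifs with h
  · have : Ioi z ∩ Iic y = Iic y \ Iic z := by ext t; simp [and_comm]
    rw [this, measureReal_sdiff (Iic_subset_Iic.2 h) measurableSet_Iic, expMeasure_real_Iic,
      expMeasure_real_Iic, if_pos hz, if_pos (hz.trans h)]
    have : Real.exp (-y) = Real.exp (-(y - z)) * Real.exp (-z) := by rw [← Real.exp_add]; ring_nf
    rw [this]; field_simp; ring
  · have : Ioi z ∩ Iic y = ∅ := by
      ext t; simp only [mem_inter_iff, mem_Ioi, mem_Iic, mem_empty_iff_false, iff_false]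
      intro ht; linarith [ht.1, ht.2]
    simp [this]

lemma cond_expMeasure_eq_map {z : ℝ} (hz : 0 ≤ z) :
    ProbabilityTheory.cond (expMeasure 1) (Ioi z) = (expMeasure 1).map (fun t => z + t) := by
  have : IsProbabilityMeasure (ProbabilityTheory.cond (expMeasure 1) (Ioi z)) :=
    cond_isProbabilityMeasure (by
      rw [expMeasure_Ioi hz]; simpa using Real.exp_pos (-z))
  have : IsProbabilityMeasure ((expMeasure 1).map (fun t => z + t)) :=
    Measure.isProbabilityMeasure_map (by fun_prop)
  refine Measure.eq_of_cdf _ _ ?_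
  ext y
  rw [cdf_eq_real, cdf_eq_real, map_measureReal_apply (by fun_prop) measurableSet_Iic]
  have h : (fun t => z + t) ⁻¹' Iic y = Iic (y - z) := by ext t; simp [le_sub_iff_add_le']
  rw [h, expMeasure_real_Iic]
  have := condCDF_expMeasure hz y
  simpa [condCDF] using this

/-- Unnormalised form of memorylessness, as it is needed for one factor of a product measure. -/
lemma expMeasure_memoryless {z : ℝ} (hz : 0 ≤ z) {s : Set ℝ} (hs : MeasurableSet s) :
    expMeasure 1 (Ioi z ∩ (fun t => t - z) ⁻¹' s)
      = ENNReal.ofReal (Real.exp (-z)) * expMeasure 1 s := by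
  have h := congrArg (fun m => m ((fun t => t - z) ⁻¹' s)) (cond_expMeasure_eq_map hz)
  have hm : MeasurableSet ((fun t : ℝ => t - z) ⁻¹' s) := hs.preimage (by fun_prop)
  rw [Measure.map_apply (by fun_prop) hm] at h
  have h2 : (fun t => z + t) ⁻¹' ((fun t : ℝ => t - z) ⁻¹' s) = s := by ext t; simp
  rw [h2] at h
  rw [← h, ← expMeasure_Ioi hz, mul_comm, cond_mul_eq_inter measurableSet_Ioi]

/-- The bound `0 < u` rules out the points below `z`, where the distribution function is `0`; the
bound `u < 1` makes the logarithm meaningful. -/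
lemma condQuantile_expMeasure {z u : ℝ} (hz : 0 ≤ z) (hu : u ∈ Ioo (0 : ℝ) 1) :
    condQuantile (expMeasure 1) z u = z - Real.log (1 - u) := by
  have : {y : ℝ | u ≤ condCDF (expMeasure 1) z y} = Ici (z - Real.log (1 - u)) := by
    ext y
    have h1 : (0 : ℝ) < 1 - u := by linarith [hu.2]
    simp only [mem_ofPred_eq, mem_Ici, condCDF_expMeasure hz]
    have h3 : Real.log (1 - u) < 0 := Real.log_neg h1 (by linarith [hu.1])
    split_ifs with h
    · have h2 : z - Real.log (1 - u) ≤ y ↔ -(y - z) ≤ Real.log (1 - u) := by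
        constructor <;> intro h <;> linarith
      rw [h2, Real.le_log_iff_exp_le h1]
      constructor <;> intro h <;> linarith
    · constructor
      · intro h'; linarith [hu.1]
      · intro h'; linarith
  rw [condQuantile, this, csInf_Ici]

lemma map_neg_log_uniform :
    (volume.restrict (Ioo (0 : ℝ) 1)).map (fun u => -Real.log (1 - u)) = expMeasure 1 := by
  have hm : Measurable fun u : ℝ => -Real.log (1 - u) := by fun_prop
  have : IsProbabilityMeasure
      ((volume.restrict (Ioo (0 : ℝ) 1)).map (fun u => -Real.log (1 - u))) :=
    Measure.isProbabilityMeasure_map hm.aemeasurable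
  refine Measure.eq_of_cdf _ _ ?_
  ext y
  rw [cdf_eq_real, cdf_eq_real, map_measureReal_apply hm measurableSet_Iic, expMeasure_real_Iic,
    measureReal_restrict_apply (hm measurableSet_Iic)]
  have key : ∀ u ∈ Ioo (0 : ℝ) 1, -Real.log (1 - u) ≤ y ↔ u ≤ 1 - Real.exp (-y) := by
    intro u hu
    have h1 : (0 : ℝ) < 1 - u := by linarith [hu.2]
    rw [neg_le, Real.le_log_iff_exp_le h1]
    constructor <;> intro h <;> linarith
  split_ifs with h
  · have h0 : 0 ≤ 1 - Real.exp (-y) := by simpa using h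
    have h1 : 1 - Real.exp (-y) < 1 := by linarith [Real.exp_pos (-y)]
    have : (fun u => -Real.log (1 - u)) ⁻¹' Iic y ∩ Ioo (0 : ℝ) 1 = Ioc 0 (1 - Real.exp (-y)) := by
      ext u
      constructor
      · rintro ⟨h2, h3⟩
        exact ⟨h3.1, (key u h3).1 h2⟩
      · rintro ⟨h2, h3⟩
        have h4 : u ∈ Ioo (0 : ℝ) 1 := ⟨h2, h3.trans_lt h1⟩
        exact ⟨(key u h4).2 h3, h4⟩
    rw [this, Real.volume_real_Ioc_of_le h0]; ring
  · have : (fun u => -Real.log (1 - u)) ⁻¹' Iic y ∩ Ioo (0 : ℝ) 1 = ∅ := by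
      ext u
      simp only [mem_inter_iff, mem_empty_iff_false, iff_false]
      rintro ⟨h2, h3⟩
      have h4 := (key u h3).1 h2
      have h5 : 1 < Real.exp (-y) := by
        rw [Real.one_lt_exp_iff]; linarith
      linarith [h3.1]
    simp [this]

/-! ### Resampling in terms of excesses over the level. -/

/-- `Tuple.sort` is characterised by monotonicity and by breaking ties in index order; a common
shift affects neither. -/
lemma sort_const_add {n : ℕ} (z : ℝ) (e : Fin n → ℝ) :
    Tuple.sort (fun i => z + e i) = Tuple.sort e := by
  symm
  rw [Tuple.eq_sort_iff]
  obtain ⟨h1, h2⟩ := (Tuple.eq_sort_iff (σ := Tuple.sort e) (f := e)).1 rfl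
  refine ⟨fun i j hij => ?_, fun i j hij h => h2 i j hij (by simpa using h)⟩
  simpa using h1 hij

lemma orderStat_eq {n k : ℕ} (hk : 1 ≤ k) (hkn : k ≤ n) (Y : Fin n → ℝ) :
    orderStat Y k = Y (Tuple.sort Y ⟨k - 1, by omega⟩) := by
  rw [orderStat, dif_pos]

lemma orderStat_const_add {n k : ℕ} (hk : 1 ≤ k) (hkn : k ≤ n) (z : ℝ) (e : Fin n → ℝ) :
    orderStat (fun i => z + e i) k = z + orderStat e k := by
  rw [orderStat_eq hk hkn, orderStat_eq hk hkn, sort_const_add]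

/-- The excesses over the new level after one step, for a sample with excesses `e` over the old
level and uniform variables `u`. -/
noncomputable def residual {n k : ℕ} (e : Fin n → ℝ) (u : Fin k → ℝ) : Fin n → ℝ := fun i =>
  if h : ((Tuple.sort e).symm i : ℕ) < k then
    -Real.log (1 - u ⟨(Tuple.sort e).symm i, h⟩)
  else e i - orderStat e k

lemma resample_const_add {n k : ℕ} (hk : 1 ≤ k) (hkn : k ≤ n) {z : ℝ} (hz : 0 ≤ z)
    {e : Fin n → ℝ} (he : ∀ i, 0 ≤ e i) {u : Fin k → ℝ} (hu : ∀ l, u l ∈ Ioo (0 : ℝ) 1) :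
    resample (expMeasure 1) (fun i => z + e i) u
      = fun i => (z + orderStat e k) + residual e u i := by
  have h0 : 0 ≤ orderStat e k := by rw [orderStat_eq hk hkn]; exact he _
  ext i
  simp only [resample, residual, sort_const_add, orderStat_const_add hk hkn]
  split_ifs with h
  · rw [condQuantile_expMeasure (add_nonneg hz h0) (hu _)]; ring
  · ring

lemma residual_nonneg {n k : ℕ} (hk : 1 ≤ k) (hkn : k ≤ n)
    (e : Fin n → ℝ) {u : Fin k → ℝ} (hu : ∀ l, u l ∈ Ioo (0 : ℝ) 1) (i : Fin n) :
    0 ≤ residual e u i := by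
  rw [residual]
  split_ifs with h
  · have := Real.log_neg (x := 1 - u ⟨(Tuple.sort e).symm i, h⟩) (by linarith [(hu ⟨_, h⟩).2])
      (by linarith [(hu ⟨_, h⟩).1])
    linarith
  · rw [orderStat_eq hk hkn, sub_nonneg]
    have := Tuple.monotone_sort e
      (show (⟨k - 1, by omega⟩ : Fin n) ≤ (Tuple.sort e).symm i from by
        rw [Fin.le_def]; simp only; omega)
    simpa using this

/-! ### Measurability of quantities defined through sorting. -/

/-- The sorting permutation takes finitely many values, each on a set cut out by finitely many
comparisons of coordinates, so measurability may be checked with the permutation frozen. -/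
lemma measurable_of_sort {n : ℕ} {α β : Type*} [MeasurableSpace α] [MeasurableSpace β]
    {Y : α → Fin n → ℝ} (hY : Measurable Y) {G : Equiv.Perm (Fin n) → α → β}
    (hG : ∀ σ, Measurable (G σ)) : Measurable fun y => G (Tuple.sort (Y y)) y := by
  let _ : MeasurableSpace (Equiv.Perm (Fin n)) := ⊤
  have hsort : Measurable fun y => Tuple.sort (Y y) := by
    refine measurable_to_countable' fun σ => ?_
    have : (fun y => Tuple.sort (Y y)) ⁻¹' {σ} = {y | (∀ i j, i ≤ j → Y y (σ i) ≤ Y y (σ j)) ∧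
        ∀ i j, i < j → Y y (σ i) = Y y (σ j) → σ i < σ j} := by
      ext y
      rw [mem_preimage, mem_singleton_iff, eq_comm, Tuple.eq_sort_iff]
      rfl
    rw [this]
    have hc : ∀ i, Measurable fun y => Y y i := fun i => (measurable_pi_apply i).comp hY
    simp only [ofPred_and, ofPred_forall]
    refine MeasurableSet.inter ?_ ?_
    · exact MeasurableSet.iInter fun i => .iInter fun j => .iInter fun _ =>
        measurableSet_le (hc _) (hc _)
    · refine MeasurableSet.iInter fun i => .iInter fun j => .iInter fun _ => ?_
      by_cases h : σ i < σ j
      · simp [h]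
      · simp only [h, imp_false]
        exact (measurableSet_eq_fun (hc _) (hc _)).compl
  exact (measurable_from_prod_countable_right (f := fun p : Equiv.Perm (Fin n) × α => G p.1 p.2)
    hG).comp (hsort.prodMk measurable_id)

lemma measurable_orderStat {n : ℕ} (k : ℕ) : Measurable fun Y : Fin n → ℝ => orderStat Y k := by
  unfold orderStat
  split_ifs with h
  · exact measurable_of_sort measurable_id (G := fun σ Y => Y (σ ⟨k - 1, h⟩))
      fun σ => measurable_pi_apply _
  · exact measurable_const

lemma measurable_residual {n k : ℕ} :
    Measurable fun p : (Fin n → ℝ) × (Fin k → ℝ) => residual p.1 p.2 := by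
  refine measurable_pi_lambda _ fun i => ?_
  refine measurable_of_sort measurable_fst (G := fun σ (p : (Fin n → ℝ) × (Fin k → ℝ)) =>
    if h : (σ.symm i : ℕ) < k then -Real.log (1 - p.2 ⟨σ.symm i, h⟩)
    else p.1 i - orderStat p.1 k) fun σ => ?_
  split_ifs with h
  · fun_prop
  · exact ((measurable_pi_apply i).comp measurable_fst).sub
      ((measurable_orderStat k).comp measurable_fst)

lemma measurable_residual_comp {n k : ℕ} {α : Type*} [MeasurableSpace α] {f : α → Fin n → ℝ}
    {g : α → Fin k → ℝ} (hf : Measurable f) (hg : Measurable g) :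
    Measurable fun a => AMS.residual (f a) (g a) := by
  have h := (measurable_residual (n := n) (k := k)).comp (hf.prodMk hg)
  exact h

/-! ### Integrating out one coordinate of a product measure. -/

lemma map_update_pi {n : ℕ} (μ : Measure ℝ) [IsProbabilityMeasure μ] (i₀ : Fin n) :
    (μ.prod (Measure.pi fun _ : Fin n => μ)).map (fun p => Function.update p.2 i₀ p.1)
      = Measure.pi fun _ => μ := by
  have hm : Measurable fun p : ℝ × (Fin n → ℝ) => Function.update p.2 i₀ p.1 := by
    refine measurable_pi_lambda _ fun i => ?_
    by_cases h : i = i₀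
    · subst h; simpa using measurable_fst
    · simp only [ne_eq, h, not_false_eq_true, Function.update_of_ne]
      exact (measurable_pi_apply i).comp measurable_snd
  symm
  refine Measure.pi_eq fun s hs => ?_
  rw [Measure.map_apply hm (MeasurableSet.univ_pi hs)]
  have : (fun p : ℝ × (Fin n → ℝ) => Function.update p.2 i₀ p.1) ⁻¹' (univ.pi s)
      = s i₀ ×ˢ univ.pi (Function.update s i₀ univ) := by
    ext p
    simp only [mem_preimage, mem_univ_pi, mem_prod]
    constructor
    · intro h
      refine ⟨by simpa using h i₀, fun i => ?_⟩
      by_cases hi : i = i₀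
      · subst hi; simp
      · simpa [hi] using h i
    · rintro ⟨h1, h2⟩ i
      by_cases hi : i = i₀
      · subst hi; simpa using h1
      · simpa [hi] using h2 i
  rw [this, Measure.prod_prod, Measure.pi_pi, ← Finset.mul_prod_erase _ _ (Finset.mem_univ i₀),
    ← Finset.mul_prod_erase Finset.univ (fun i => μ (s i)) (Finset.mem_univ i₀)]
  simp only [Function.update_self, measure_univ, one_mul]
  congr 1
  refine Finset.prod_congr rfl fun i hi => ?_
  rw [Function.update_of_ne (Finset.ne_of_mem_erase hi)]

/-- Fubini with the coordinate `i₀` singled out. Replacing this coordinate by an independent copy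
keeps the index type `Fin n`; the overwritten coordinate is unconstrained and contributes a factor
`1`. -/
lemma pi_slice {n : ℕ} (μ : Measure ℝ) [IsProbabilityMeasure μ] (i₀ : Fin n) {B : Set ℝ}
    (hB : MeasurableSet B) (C : Fin n → ℝ → Set ℝ)
    (hC : ∀ i, MeasurableSet {p : ℝ × ℝ | p.2 ∈ C i p.1}) :
    Measure.pi (fun _ : Fin n => μ) {e | e i₀ ∈ B ∧ ∀ i, i ≠ i₀ → e i ∈ C i (e i₀)}
      = ∫⁻ z in B, ∏ i ∈ Finset.univ.erase i₀, μ (C i z) ∂μ := by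
  have hm : Measurable fun p : ℝ × (Fin n → ℝ) => Function.update p.2 i₀ p.1 := by
    refine measurable_pi_lambda _ fun i => ?_
    by_cases h : i = i₀
    · subst h; simpa using measurable_fst
    · simp only [ne_eq, h, not_false_eq_true, Function.update_of_ne]
      exact (measurable_pi_apply i).comp measurable_snd
  have hms : MeasurableSet {e : Fin n → ℝ | e i₀ ∈ B ∧ ∀ i, i ≠ i₀ → e i ∈ C i (e i₀)} := by
    simp only [ofPred_and, ofPred_forall]
    refine MeasurableSet.inter (hB.preimage (measurable_pi_apply i₀)) ?_
    refine .iInter fun i => .iInter fun _ => ?_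
    have h : Measurable fun e : Fin n → ℝ => (e i₀, e i) :=
      (measurable_pi_apply i₀).prodMk (measurable_pi_apply i)
    exact h (hC i)
  rw [← map_update_pi μ i₀, Measure.map_apply hm hms, Measure.prod_apply (hm hms),
    ← lintegral_indicator hB]
  refine lintegral_congr fun z => ?_
  by_cases hz : z ∈ B
  · rw [indicator_of_mem hz]
    have : Prod.mk z ⁻¹' ((fun p : ℝ × (Fin n → ℝ) => Function.update p.2 i₀ p.1) ⁻¹'
        {e | e i₀ ∈ B ∧ ∀ i, i ≠ i₀ → e i ∈ C i (e i₀)})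
        = univ.pi (Function.update (fun i => C i z) i₀ univ) := by
      ext e
      simp only [mem_preimage, mem_ofPred_eq, Function.update_self, hz, true_and, mem_univ_pi]
      refine forall_congr' fun i => ?_
      by_cases hi : i = i₀
      · subst hi; simp
      · simp [hi]
    rw [this, Measure.pi_pi, ← Finset.mul_prod_erase _ _ (Finset.mem_univ i₀)]
    simp only [Function.update_self, measure_univ, one_mul]
    refine Finset.prod_congr rfl fun i hi => ?_
    rw [Function.update_of_ne (Finset.ne_of_mem_erase hi)]
  · rw [indicator_of_notMem hz]
    convert measure_empty (μ := Measure.pi fun _ : Fin n => μ)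
    ext e
    simp [hz]

/-! ### The law of one step: increment and new excesses. -/

/-- The density, with respect to the exponential law, of the law of the `k`-th order statistic of
an `n`-sample of the exponential law. -/
noncomputable def stepDensity (n k : ℕ) (z : ℝ) : ℝ≥0∞ :=
  (k * n.choose k : ℕ) * (ENNReal.ofReal (1 - Real.exp (-z)) ^ (k - 1)
    * ENNReal.ofReal (Real.exp (-z)) ^ (n - k))

/-- The law of the `k`-th order statistic of an `n`-sample of the exponential law. -/
noncomputable def stepLaw (n k : ℕ) : Measure ℝ := (expMeasure 1).withDensity (stepDensity n k)

lemma measurable_stepDensity (n k : ℕ) : Measurable (stepDensity n k) := by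
  unfold stepDensity; fun_prop

lemma ae_expMeasure_pos : ∀ᵐ z ∂(expMeasure 1), 0 < z := by
  have h : expMeasure 1 (Iic 0) = 0 := by rw [expMeasure_Iic le_rfl]; simp
  refine (measure_eq_zero_iff_ae_notMem.1 h).mono fun z hz => ?_
  simpa using hz

/-- A crude bound on the density suffices here; that the total mass is one comes out of
`map_orderStat_residual`. -/
instance (n k : ℕ) : IsFiniteMeasure (stepLaw n k) := by
  refine isFiniteMeasure_withDensity (ne_of_lt ?_)
  calc ∫⁻ z, stepDensity n k z ∂(expMeasure 1)
      ≤ ∫⁻ z, (k * n.choose k : ℕ) ∂(expMeasure 1) := by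
        refine lintegral_mono_ae ?_
        filter_upwards [ae_expMeasure_pos] with z hz
        refine mul_le_of_le_one_right' (mul_le_one' (pow_le_one' ?_ _) (pow_le_one' ?_ _))
        · rw [← ENNReal.ofReal_one]
          exact ENNReal.ofReal_le_ofReal (by linarith [Real.exp_pos (-z)])
        · rw [← ENNReal.ofReal_one]
          exact ENNReal.ofReal_le_ofReal (by simpa using hz.le)
    _ < ∞ := by simp [ENNReal.mul_lt_top]

lemma expMeasure_singleton (z : ℝ) : expMeasure 1 {z} = 0 :=
  withDensity_absolutelyContinuous volume (gammaPDF 1 1) (measure_singleton z)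

/-- Given `e i`, the event `e j = e i` confines another coordinate to a singleton, which has measure
zero. -/
lemma ae_pi_injective (n : ℕ) :
    ∀ᵐ e ∂(Measure.pi fun _ : Fin n => expMeasure 1), Function.Injective e := by
  have : ∀ i j : Fin n, i ≠ j →
      ∀ᵐ e ∂(Measure.pi fun _ : Fin n => expMeasure 1), e i ≠ e j := by
    intro i j hij
    rw [ae_iff]
    have h := pi_slice (expMeasure 1) i MeasurableSet.univ
      (fun l z => if l = j then {z} else univ) (by
        intro l
        by_cases h : l = j
        · simp only [h, if_true, mem_singleton_iff]
          exact measurableSet_eq_fun measurable_snd measurable_fst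
        · simp [h])
    have h0 : ∀ z : ℝ, ∏ l ∈ Finset.univ.erase i,
        expMeasure 1 (if l = j then {z} else univ) = 0 := fun z =>
      Finset.prod_eq_zero (Finset.mem_erase.2 ⟨hij.symm, Finset.mem_univ j⟩) (by simp [expMeasure_singleton])
    simp only [h0, lintegral_zero] at h
    refine measure_mono_null (fun e he => ?_) h
    simp only [mem_ofPred_eq, ne_eq, not_not] at he ⊢
    refine ⟨mem_univ _, fun l _ => ?_⟩
    split_ifs with hl
    · subst hl; exact he.symm
    · trivial
  have h2 : ∀ᵐ e ∂(Measure.pi fun _ : Fin n => expMeasure 1), ∀ i j : Fin n, i ≠ j → e i ≠ e j := by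
    rw [ae_all_iff]; intro i; rw [ae_all_iff]; intro j
    by_cases h : i = j
    · simp [h]
    · filter_upwards [this i j h] with e he _ using he
  filter_upwards [h2] with e he i j hij
  by_contra h
  exact he i j h hij

/-- The probability, over the uniform variables, that the residuals lie in `∏ s i`. -/
lemma pi_uniform_residual_mem {n k : ℕ} (hkn : k ≤ n) (e : Fin n → ℝ)
    {s : Fin n → Set ℝ} (hs : ∀ i, MeasurableSet (s i)) :
    Measure.pi (fun _ : Fin k => volume.restrict (Ioo (0 : ℝ) 1))
        {u | residual e u ∈ univ.pi s}
      = ∏ i, if ((Tuple.sort e).symm i : ℕ) < k then expMeasure 1 (s i)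
          else (s i).indicator (fun _ => 1) (e i - orderStat e k) := by
  classical
  set σ := Tuple.sort e with hσ
  have hm : Measurable fun u : ℝ => -Real.log (1 - u) := by fun_prop
  rw [Finset.prod_ite]
  have h1 : ∏ i with ((σ.symm i : ℕ) < k), expMeasure 1 (s i)
      = ∏ l : Fin k, expMeasure 1 (s (σ (Fin.castLE hkn l))) := by
    symm
    refine Finset.prod_bij (fun l _ => σ (Fin.castLE hkn l)) ?_ ?_ ?_ ?_
    · intro l _; simp
    · intro l _ l' _ h; simpa using h
    · intro i hi
      simp only [Finset.mem_filter, Finset.mem_univ, true_and] at hi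
      exact ⟨⟨_, hi⟩, Finset.mem_univ _, by simp⟩
    · intro l _; rfl
  by_cases hall : ∀ i, ¬ ((σ.symm i : ℕ) < k) → e i - orderStat e k ∈ s i
  · have h2 : ∏ i with ¬ ((σ.symm i : ℕ) < k),
        (s i).indicator (fun _ => (1 : ℝ≥0∞)) (e i - orderStat e k) = 1 := by
      refine Finset.prod_eq_one fun i hi => ?_
      simp only [Finset.mem_filter, Finset.mem_univ, true_and] at hi
      rw [indicator_of_mem (hall i hi)]
    rw [h1, h2, mul_one]
    -- The kept particles satisfy their constraints, and the particle of rank `l` reads only `u l`,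
    -- so the event is a box.
    have : {u : Fin k → ℝ | residual e u ∈ univ.pi s}
        = univ.pi fun l => (fun u : ℝ => -Real.log (1 - u)) ⁻¹' s (σ (Fin.castLE hkn l)) := by
      ext u
      simp only [mem_ofPred_eq, mem_univ_pi, mem_preimage]
      constructor
      · intro h l
        have := h (σ (Fin.castLE hkn l))
        simpa [residual, ← hσ] using this
      · intro h i
        rw [residual]
        split_ifs with hi
        · have := h ⟨_, hi⟩
          simpa [← hσ] using this
        · exact hall i hi
    rw [this, Measure.pi_pi]
    refine Finset.prod_congr rfl fun l _ => ?_
    rw [← Measure.map_apply hm (hs _), map_neg_log_uniform]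
  · push Not at hall
    obtain ⟨i, hi, his⟩ := hall
    have h2 : ∏ i with ¬ ((σ.symm i : ℕ) < k),
        (s i).indicator (fun _ => (1 : ℝ≥0∞)) (e i - orderStat e k) = 0 :=
      Finset.prod_eq_zero (i := i) (by simpa using hi) (indicator_of_notMem his _)
    rw [h2, mul_zero]
    convert measure_empty (μ := Measure.pi fun _ : Fin k => volume.restrict (Ioo (0 : ℝ) 1))
    ext u
    simp only [mem_ofPred_eq, mem_univ_pi, mem_empty_iff_false, iff_false, not_forall]
    refine ⟨i, ?_⟩
    rw [residual, dif_neg (by simpa using hi)]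
    exact his

/-- The event that the sample `e` has its `k`-th smallest value at `i₀`, that this value lies in
`B`, that the values up to it are those with indices in `L`, and that the excesses of the others
lie in the sets `s i`. -/
def splitEvent {n : ℕ} (B : Set ℝ) (s : Fin n → Set ℝ) (L : Finset (Fin n)) (i₀ : Fin n) :
    Set (Fin n → ℝ) :=
  {e | e i₀ ∈ B ∧ ∀ i, i ≠ i₀ →
    e i ∈ (fun z : ℝ => if i ∈ L then Iic z else Ioi z ∩ (fun t => t - z) ⁻¹' s i) (e i₀)}

lemma measurableSet_splitEvent_aux {n : ℕ} {s : Fin n → Set ℝ} (hs : ∀ i, MeasurableSet (s i))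
    (L : Finset (Fin n)) (i : Fin n) :
    MeasurableSet {p : ℝ × ℝ |
      p.2 ∈ if i ∈ L then Iic p.1 else Ioi p.1 ∩ (fun t => t - p.1) ⁻¹' s i} := by
  split_ifs with h
  · exact measurableSet_le measurable_snd measurable_fst
  · have h1 : Measurable fun p : ℝ × ℝ => p.2 - p.1 := by fun_prop
    exact (measurableSet_lt measurable_fst measurable_snd).inter (h1 (hs i))

lemma measurableSet_splitEvent {n : ℕ} {B : Set ℝ} (hB : MeasurableSet B) {s : Fin n → Set ℝ}
    (hs : ∀ i, MeasurableSet (s i)) (L : Finset (Fin n)) (i₀ : Fin n) :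
    MeasurableSet (splitEvent B s L i₀) := by
  simp only [splitEvent, ofPred_and, ofPred_forall]
  refine MeasurableSet.inter (hB.preimage (measurable_pi_apply i₀)) ?_
  refine .iInter fun i => .iInter fun _ => ?_
  have h : Measurable fun e : Fin n → ℝ => (e i₀, e i) :=
    (measurable_pi_apply i₀).prodMk (measurable_pi_apply i)
  exact h (measurableSet_splitEvent_aux hs L i)

/-- Given `e i₀ = z`, the other `k - 1` indices of `L` contribute `1 - e^{-z}` each, and each index
outside `L` contributes `e^{-z}` times the measure of `s i`, by memorylessness. The factor over `L`,
which comes from the resampled particles, completes the product over all indices, so the result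
depends neither on `L` nor on `i₀`. -/
lemma prod_mul_pi_splitEvent {n k : ℕ} {B : Set ℝ} (hB : MeasurableSet B) {s : Fin n → Set ℝ}
    (hs : ∀ i, MeasurableSet (s i)) {L : Finset (Fin n)} (hL : L.card = k) {i₀ : Fin n}
    (hi₀ : i₀ ∈ L) :
    (∏ i ∈ L, expMeasure 1 (s i)) * Measure.pi (fun _ => expMeasure 1) (splitEvent B s L i₀)
      = (∏ i, expMeasure 1 (s i)) * ∫⁻ z in B, (ENNReal.ofReal (1 - Real.exp (-z)) ^ (k - 1)
          * ENNReal.ofReal (Real.exp (-z)) ^ (n - k)) ∂(expMeasure 1) := by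
  classical
  have key : ∀ z : ℝ, 0 < z →
      ∏ i ∈ Finset.univ.erase i₀,
        expMeasure 1 (if i ∈ L then Iic z else Ioi z ∩ (fun t => t - z) ⁻¹' s i)
      = (∏ i ∈ Lᶜ, expMeasure 1 (s i)) * (ENNReal.ofReal (1 - Real.exp (-z)) ^ (k - 1)
          * ENNReal.ofReal (Real.exp (-z)) ^ (n - k)) := by
    intro z hz
    have h1 : Finset.univ.erase i₀ = L.erase i₀ ∪ Lᶜ := by
      ext i; by_cases h : i = i₀ <;> simp [h, hi₀, em]
    have hd : Disjoint (L.erase i₀) Lᶜ := by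
      rw [Finset.disjoint_left]
      intro i hi hi'
      exact (Finset.mem_compl.1 hi') (Finset.mem_of_mem_erase hi)
    rw [h1, Finset.prod_union hd]
    have h2 : ∏ i ∈ L.erase i₀,
        expMeasure 1 (if i ∈ L then Iic z else Ioi z ∩ (fun t => t - z) ⁻¹' s i)
        = ENNReal.ofReal (1 - Real.exp (-z)) ^ (k - 1) := by
      rw [← hL, ← Finset.card_erase_of_mem hi₀]
      refine Finset.prod_eq_pow_card fun i hi => ?_
      rw [if_pos (Finset.mem_of_mem_erase hi), expMeasure_Iic hz.le]
    have h3 : ∏ i ∈ Lᶜ,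
        expMeasure 1 (if i ∈ L then Iic z else Ioi z ∩ (fun t => t - z) ⁻¹' s i)
        = ENNReal.ofReal (Real.exp (-z)) ^ (n - k) * ∏ i ∈ Lᶜ, expMeasure 1 (s i) := by
      have : (Lᶜ).card = n - k := by rw [Finset.card_compl, hL, Fintype.card_fin]
      rw [← this, ← Finset.prod_const, ← Finset.prod_mul_distrib]
      refine Finset.prod_congr rfl fun i hi => ?_
      rw [if_neg (Finset.mem_compl.1 hi), expMeasure_memoryless hz.le (hs i)]
    rw [h2, h3]; ring
  rw [splitEvent, pi_slice (expMeasure 1) i₀ hB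
    (fun i z => if i ∈ L then Iic z else Ioi z ∩ (fun t => t - z) ⁻¹' s i)
    (measurableSet_splitEvent_aux hs L)]
  have : ∫⁻ z in B, ∏ i ∈ Finset.univ.erase i₀,
        expMeasure 1 (if i ∈ L then Iic z else Ioi z ∩ (fun t => t - z) ⁻¹' s i) ∂(expMeasure 1)
      = ∫⁻ z in B, (∏ i ∈ Lᶜ, expMeasure 1 (s i)) *
        (ENNReal.ofReal (1 - Real.exp (-z)) ^ (k - 1)
          * ENNReal.ofReal (Real.exp (-z)) ^ (n - k)) ∂(expMeasure 1) := by
    refine lintegral_congr_ae (ae_restrict_of_ae ?_)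
    filter_upwards [ae_expMeasure_pos] with z hz using key z hz
  rw [this, lintegral_const_mul _ (by fun_prop), ← mul_assoc, Finset.prod_mul_prod_compl]

/-- Without ties only one pair `(L, i₀)` can contribute: the indices of the `k` smallest values, and
the index of the largest among these. -/
lemma indicator_mul_prod_eq_sum {n k : ℕ} (hk : 1 ≤ k) (hkn : k ≤ n) (B : Set ℝ)
    (s : Fin n → Set ℝ) {e : Fin n → ℝ} (he : Function.Injective e) :
    (B.indicator (fun _ => (1 : ℝ≥0∞)) (orderStat e k) *
      ∏ i, if ((Tuple.sort e).symm i : ℕ) < k then expMeasure 1 (s i)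
          else (s i).indicator (fun _ => 1) (e i - orderStat e k))
      = ∑ L ∈ Finset.powersetCard k Finset.univ, ∑ i₀ ∈ L,
        (∏ i ∈ L, expMeasure 1 (s i)) * (splitEvent B s L i₀).indicator (fun _ => 1) e := by
  classical
  set σ := Tuple.sort e with hσ
  have hsm : StrictMono (e ∘ σ) :=
    (Tuple.monotone_sort e).strictMono_of_injective (he.comp σ.injective)
  have hle : ∀ i j, e i ≤ e j ↔ σ.symm i ≤ σ.symm j := by
    intro i j
    have := hsm.le_iff_le (a := σ.symm i) (b := σ.symm j)
    simpa using this
  set m : Fin n := ⟨k - 1, by omega⟩ with hm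
  set L₀ : Finset (Fin n) := Finset.univ.filter fun i => (σ.symm i : ℕ) < k with hL₀
  have hO : orderStat e k = e (σ m) := orderStat_eq hk hkn e
  have hcard : ∀ j : Fin n, (Finset.univ.filter fun i => e i ≤ e j).card = σ.symm j + 1 := by
    intro j
    have : (Finset.univ.filter fun i => e i ≤ e j) = (Finset.Iic (σ.symm j)).map σ.toEmbedding := by
      ext i
      simp only [Finset.mem_filter, Finset.mem_univ, true_and, hle, Finset.mem_map_equiv,
        Finset.mem_Iic]
    rw [this, Finset.card_map, Fin.card_Iic]
  have hL₀' : L₀ = Finset.univ.filter fun i => e i ≤ e (σ m) := by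
    ext i
    simp only [hL₀, Finset.mem_filter, Finset.mem_univ, true_and, hle, Equiv.symm_apply_apply,
      Fin.le_def, hm]
    omega
  have hL₀card : L₀.card = k := by
    rw [hL₀', hcard, Equiv.symm_apply_apply]; simp only [hm]; omega
  have hmem : σ m ∈ L₀ := by rw [hL₀']; simp
  -- The event forces `L` to be the sublevel set of `e i₀`; its cardinality `k` then fixes the rank
  -- of `i₀`, which is `k - 1` when counted from `0`.
  have huniq : ∀ L : Finset (Fin n), L.card = k → ∀ i₀ ∈ L, e ∈ splitEvent B s L i₀ →
      L = L₀ ∧ i₀ = σ m := by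
    intro L hL i₀ hi₀ hmemL
    have h1 : L = Finset.univ.filter fun i => e i ≤ e i₀ := by
      ext i
      simp only [Finset.mem_filter, Finset.mem_univ, true_and]
      by_cases h : i = i₀
      · subst h; simp [hi₀]
      · have := hmemL.2 i h
        by_cases hi : i ∈ L
        · simpa [hi] using this
        · simp only [hi, if_false, mem_inter_iff, mem_Ioi] at this
          simp [hi, this.1]
    have h2 := hcard i₀
    rw [← h1, hL] at h2
    have h3 : i₀ = σ m := by
      rw [← Equiv.symm_apply_eq]
      ext
      simp only [hm]; omega
    exact ⟨by rw [h1, hL₀', h3], h3⟩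
  rw [Finset.sum_eq_single L₀, Finset.sum_eq_single (σ m)]
  · rw [Finset.prod_ite, hO]
    have hA : e ∈ splitEvent B s L₀ (σ m) ↔
        e (σ m) ∈ B ∧ ∀ i, i ∉ L₀ → e i - e (σ m) ∈ s i := by
      rw [splitEvent, mem_ofPred_eq]
      refine and_congr_right fun _ => forall_congr' fun i => ?_
      by_cases hi : i ∈ L₀
      · have : e i ≤ e (σ m) := by rw [hL₀'] at hi; simpa using hi
        simp [hi, this]
      · have h1 : e (σ m) < e i := by rw [hL₀'] at hi; simpa using hi
        have h2 : i ≠ σ m := by rintro rfl; exact hi hmem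
        simp [hi, h1, h2]
    by_cases hB : e (σ m) ∈ B
    · by_cases hall : ∀ i, i ∉ L₀ → e i - e (σ m) ∈ s i
      · rw [indicator_of_mem hB, indicator_of_mem (hA.2 ⟨hB, hall⟩), one_mul, mul_one]
        rw [Finset.prod_eq_one (s := Finset.univ.filter fun i => ¬ ((σ.symm i : ℕ) < k)), mul_one]
        intro i hi
        refine indicator_of_mem (hall i ?_) _
        simpa [hL₀] using hi
      · rw [indicator_of_notMem (fun h => hall (hA.1 h).2), mul_zero]
        push Not at hall
        obtain ⟨i, hi, his⟩ := hall
        rw [Finset.prod_eq_zero (s := Finset.univ.filter fun i => ¬ ((σ.symm i : ℕ) < k)) (i := i)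
          (by simpa [hL₀] using hi) (indicator_of_notMem his _), mul_zero, mul_zero]
    · rw [indicator_of_notMem hB, indicator_of_notMem (fun h => hB (hA.1 h).1), zero_mul, mul_zero]
  · intro i₀ hi₀ hne
    rw [indicator_of_notMem, mul_zero]
    exact fun h => hne (huniq L₀ hL₀card i₀ hi₀ h).2
  · exact fun h => absurd hmem h
  · intro L hL hne
    refine Finset.sum_eq_zero fun i₀ hi₀ => ?_
    rw [indicator_of_notMem, mul_zero]
    exact fun h => hne (huniq L (Finset.mem_powersetCard.1 hL).2 i₀ hi₀ h).1
  · intro h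
    exact absurd (Finset.mem_powersetCard.2 ⟨Finset.subset_univ _, hL₀card⟩) h

/-- For an exponential sample, the new level and the resampled excesses over it are independent,
and the latter form again an exponential sample. -/
theorem map_orderStat_residual {n k : ℕ} (hk : 1 ≤ k) (hkn : k ≤ n) :
    ((Measure.pi fun _ : Fin n => expMeasure 1).prod
        (Measure.pi fun _ : Fin k => volume.restrict (Ioo (0 : ℝ) 1))).map
      (fun p => (orderStat p.1 k, residual p.1 p.2))
      = (stepLaw n k).prod (Measure.pi fun _ : Fin n => expMeasure 1) := by
  classical
  have hO : Measurable fun p : (Fin n → ℝ) × (Fin k → ℝ) => orderStat p.1 k :=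
    (measurable_orderStat k).comp measurable_fst
  have hm : Measurable fun p : (Fin n → ℝ) × (Fin k → ℝ) =>
      (orderStat p.1 k, residual p.1 p.2) := hO.prodMk measurable_residual
  set Q := (Measure.pi fun _ : Fin n => expMeasure 1).prod
        (Measure.pi fun _ : Fin k => volume.restrict (Ioo (0 : ℝ) 1)) with hQ
  have rect : ∀ B : Set ℝ, MeasurableSet B → ∀ s : Fin n → Set ℝ, (∀ i, MeasurableSet (s i)) →
      Q ((fun p => (orderStat p.1 k, residual p.1 p.2)) ⁻¹' (B ×ˢ univ.pi s))
        = stepLaw n k B * ∏ i, expMeasure 1 (s i) := by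
    intro B hB s hs
    rw [hQ, Measure.prod_apply (hm (hB.prod (MeasurableSet.univ_pi hs)))]
    have h1 : ∀ e : Fin n → ℝ, Measure.pi (fun _ : Fin k => volume.restrict (Ioo (0 : ℝ) 1))
        (Prod.mk e ⁻¹' ((fun p : (Fin n → ℝ) × (Fin k → ℝ) =>
          (orderStat p.1 k, residual p.1 p.2)) ⁻¹' (B ×ˢ univ.pi s)))
        = B.indicator (fun _ => (1 : ℝ≥0∞)) (orderStat e k) *
          ∏ i, if ((Tuple.sort e).symm i : ℕ) < k then expMeasure 1 (s i)
          else (s i).indicator (fun _ => 1) (e i - orderStat e k) := by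
      intro e
      rw [← pi_uniform_residual_mem hkn e hs]
      by_cases h : orderStat e k ∈ B
      · rw [indicator_of_mem h, one_mul]
        congr 1
        ext u
        simp [h]
      · rw [indicator_of_notMem h, zero_mul]
        convert measure_empty (μ := Measure.pi fun _ : Fin k => volume.restrict (Ioo (0 : ℝ) 1))
        ext u
        simp [h]
    simp_rw [h1]
    have h2 : ∀ᵐ e ∂(Measure.pi fun _ : Fin n => expMeasure 1),
        (B.indicator (fun _ => (1 : ℝ≥0∞)) (orderStat e k) *
          ∏ i, if ((Tuple.sort e).symm i : ℕ) < k then expMeasure 1 (s i)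
          else (s i).indicator (fun _ => 1) (e i - orderStat e k)) =
        ∑ L ∈ Finset.powersetCard k Finset.univ, ∑ i₀ ∈ L,
          (∏ i ∈ L, expMeasure 1 (s i)) * (splitEvent B s L i₀).indicator (fun _ => 1) e := by
      filter_upwards [ae_pi_injective n] with e he
      exact indicator_mul_prod_eq_sum hk hkn B s he
    rw [lintegral_congr_ae h2, lintegral_finsetSum _ fun L _ => by
      refine Finset.measurable_sum _ fun i₀ _ => ?_
      exact (measurable_const.indicator (measurableSet_splitEvent hB hs L i₀)).const_mul _]
    -- All pairs contribute equally: `k` choices of `i₀` for each of the `n.choose k` sets `L`,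
    -- which is the constant in `stepDensity`.
    have h3 : ∀ L ∈ Finset.powersetCard k (Finset.univ : Finset (Fin n)),
        ∫⁻ e, ∑ i₀ ∈ L, (∏ i ∈ L, expMeasure 1 (s i)) *
          (splitEvent B s L i₀).indicator (fun _ => 1) e ∂(Measure.pi fun _ => expMeasure 1)
        = k * ((∏ i, expMeasure 1 (s i)) *
          ∫⁻ z in B, (ENNReal.ofReal (1 - Real.exp (-z)) ^ (k - 1)
          * ENNReal.ofReal (Real.exp (-z)) ^ (n - k)) ∂(expMeasure 1)) := by
      intro L hL
      have hLc := (Finset.mem_powersetCard.1 hL).2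
      rw [lintegral_finsetSum _ fun i₀ _ =>
        (measurable_const.indicator (measurableSet_splitEvent hB hs L i₀)).const_mul _]
      have h4 : ∀ i₀ ∈ L, ∫⁻ e, (∏ i ∈ L, expMeasure 1 (s i)) *
          (splitEvent B s L i₀).indicator (fun _ => 1) e ∂(Measure.pi fun _ => expMeasure 1)
          = (∏ i, expMeasure 1 (s i)) *
          ∫⁻ z in B, (ENNReal.ofReal (1 - Real.exp (-z)) ^ (k - 1)
          * ENNReal.ofReal (Real.exp (-z)) ^ (n - k)) ∂(expMeasure 1) := by
        intro i₀ hi₀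
        rw [lintegral_const_mul _
          (measurable_const.indicator (measurableSet_splitEvent hB hs L i₀)),
          lintegral_indicator_const (measurableSet_splitEvent hB hs L i₀), one_mul,
          prod_mul_pi_splitEvent hB hs hLc hi₀]
      rw [Finset.sum_congr rfl h4, Finset.sum_const, hLc, nsmul_eq_mul]
    rw [Finset.sum_congr rfl h3, Finset.sum_const, Finset.card_powersetCard, Finset.card_univ,
      Fintype.card_fin, nsmul_eq_mul, stepLaw, withDensity_apply _ hB]
    unfold stepDensity
    rw [lintegral_const_mul _ (by fun_prop)]
    push_cast
    ring
  symm
  refine Measure.prod_eq fun B t hB ht => ?_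
  rw [Measure.map_apply hm (hB.prod ht)]
  have hR : Measurable fun p : (Fin n → ℝ) × (Fin k → ℝ) => residual p.1 p.2 :=
    measurable_residual
  -- For fixed `B`, boxes form a π-system generating the product σ-algebra, so the box formula
  -- extends to every measurable `t`.
  have hext : (Q.restrict ((fun p => orderStat p.1 k) ⁻¹' B)).map
      (fun p : (Fin n → ℝ) × (Fin k → ℝ) => residual p.1 p.2)
      = (stepLaw n k B) • (Measure.pi fun _ : Fin n => expMeasure 1) := by
    have hpi : ∀ s : Fin n → Set ℝ, (∀ i, MeasurableSet (s i)) →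
        (Q.restrict ((fun p => orderStat p.1 k) ⁻¹' B)).map
          (fun p : (Fin n → ℝ) × (Fin k → ℝ) => residual p.1 p.2) (univ.pi s)
        = ((stepLaw n k B) • (Measure.pi fun _ : Fin n => expMeasure 1)) (univ.pi s) := by
      intro s hs
      rw [Measure.map_apply hR (MeasurableSet.univ_pi hs), Measure.restrict_apply
        (hR (MeasurableSet.univ_pi hs)), Measure.smul_apply, Measure.pi_pi, smul_eq_mul,
        ← rect B hB s hs]
      congr 1
      ext p
      simp [and_comm]
    refine ext_of_generate_finite _ generateFrom_pi.symm isPiSystem_pi ?_ ?_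
    · rintro _ ⟨s, hs, rfl⟩
      exact hpi s fun i => hs i (mem_univ i)
    · have := hpi (fun _ => univ) fun _ => MeasurableSet.univ
      rwa [pi_univ] at this
  have := congrArg (fun m => m t) hext
  simp only [Measure.smul_apply, smul_eq_mul] at this
  rw [← this, Measure.map_apply hR ht, Measure.restrict_apply (hR ht)]
  congr 1
  ext p
  simp [and_comm]

/-- Comparing total masses in `map_orderStat_residual` replaces the evaluation of a Beta integral.
-/
lemma isProbabilityMeasure_stepLaw {n k : ℕ} (hk : 1 ≤ k) (hkn : k ≤ n) :
    IsProbabilityMeasure (stepLaw n k) := by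
  refine ⟨?_⟩
  have h := congrArg (fun m => m univ) (map_orderStat_residual hk hkn)
  have hm : Measurable fun p : (Fin n → ℝ) × (Fin k → ℝ) =>
      (orderStat p.1 k, residual p.1 p.2) :=
    ((measurable_orderStat k).comp measurable_fst).prodMk measurable_residual
  simp only at h
  rw [Measure.map_apply hm MeasurableSet.univ, preimage_univ, measure_univ,
    ← univ_prod_univ, Measure.prod_prod,
    measure_univ (μ := Measure.pi fun _ : Fin n => expMeasure 1), mul_one] at h
  exact h.symm

/-! ### The chain of levels and excesses, and its law. -/

/-- One iteration, in terms of the level and of the excesses of the particles over it. -/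
noncomputable def chainStep {n k : ℕ} (p : (ℝ × (Fin n → ℝ)) × (Fin k → ℝ)) : ℝ × (Fin n → ℝ) :=
  (p.1.1 + orderStat p.1.2 k, residual p.1.2 p.2)

lemma measurable_chainStep {n k : ℕ} :
    Measurable (chainStep : (ℝ × (Fin n → ℝ)) × (Fin k → ℝ) → ℝ × (Fin n → ℝ)) := by
  have h : Measurable fun p : (ℝ × (Fin n → ℝ)) × (Fin k → ℝ) => p.1.2 :=
    measurable_snd.comp measurable_fst
  have h1 : Measurable fun p : (ℝ × (Fin n → ℝ)) × (Fin k → ℝ) => p.1.1 :=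
    measurable_fst.comp measurable_fst
  have h2 : Measurable fun p : (ℝ × (Fin n → ℝ)) × (Fin k → ℝ) => orderStat p.1.2 k :=
    (measurable_orderStat k).comp h
  have h3 : Measurable fun p : (ℝ × (Fin n → ℝ)) × (Fin k → ℝ) => residual p.1.2 p.2 :=
    measurable_residual_comp h measurable_snd
  exact (h1.add h2).prodMk h3

/-- The level reached by the algorithm and the excesses of the particles over it. -/
noncomputable def excessChain {n k : ℕ} (x : ℝ) (X₀ : Fin n → ℝ) (u : ℕ → Fin k → ℝ) :
    ℕ → ℝ × (Fin n → ℝ)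
  | 0 => (x, fun i => X₀ i - x)
  | j + 1 => chainStep (excessChain x X₀ u j, u j)

section Deterministic

variable {n k : ℕ} (hk : 1 ≤ k) (hkn : k ≤ n) {x : ℝ} (hx : 0 ≤ x) {X₀ : Fin n → ℝ}
  (hX : ∀ i, x ≤ X₀ i) {u : ℕ → Fin k → ℝ} (hu : ∀ j l, u j l ∈ Ioo (0 : ℝ) 1)

include hk hkn hX hu in
lemma excessChain_snd_nonneg (j : ℕ) (i : Fin n) : 0 ≤ (excessChain x X₀ u j).2 i := by
  cases j with
  | zero => simpa [excessChain] using hX i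
  | succ j => exact residual_nonneg hk hkn _ (hu j) i

include hk hkn hX hu in
lemma excessChain_fst_mono : Monotone fun j => (excessChain x X₀ u j).1 := by
  refine monotone_nat_of_le_succ fun j => ?_
  simp only [excessChain, chainStep, le_add_iff_nonneg_right]
  rw [orderStat_eq hk hkn]
  exact excessChain_snd_nonneg hk hkn hX hu j _

include hk hkn hx hX hu in
lemma particles_eq_excessChain (j : ℕ) :
    particles (expMeasure 1) X₀ u j
      = fun i => (excessChain x X₀ u j).1 + (excessChain x X₀ u j).2 i := by
  induction j with
  | zero => ext i; simp [particles, excessChain]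
  | succ j ih =>
    rw [particles, ih, resample_const_add hk hkn _ (excessChain_snd_nonneg hk hkn hX hu j) (hu j)]
    · rfl
    · exact hx.trans (excessChain_fst_mono hk hkn hX hu (Nat.zero_le j))

include hk hkn hx hX hu in
lemma level_eq_excessChain (j : ℕ) :
    level (expMeasure 1) x X₀ u j = (excessChain x X₀ u j).1 := by
  cases j with
  | zero => rfl
  | succ j =>
    rw [level, particles_eq_excessChain hk hkn hx hX hu, orderStat_const_add hk hkn]
    rfl

end Deterministic

/-- The law of the level after `j` iterations. -/
noncomputable def levelLaw (n k : ℕ) (x : ℝ) : ℕ → Measure ℝ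
  | 0 => Measure.dirac x
  | j + 1 => ((levelLaw n k x j).prod (stepLaw n k)).map fun p => p.1 + p.2

lemma isProbabilityMeasure_levelLaw {n k : ℕ} (hk : 1 ≤ k) (hkn : k ≤ n) (x : ℝ) (j : ℕ) :
    IsProbabilityMeasure (levelLaw n k x j) := by
  have := isProbabilityMeasure_stepLaw hk hkn
  induction j with
  | zero => rw [levelLaw]; infer_instance
  | succ j ih => exact Measure.isProbabilityMeasure_map (by fun_prop)

/-- After reassociating the factors, `map_orderStat_residual` acts on the excesses and the uniform
variables alone; adding the increment to the independent old level then leaves the new excesses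
untouched. -/
lemma map_step {n k : ℕ} (hk : 1 ≤ k) (hkn : k ≤ n) (η : Measure ℝ) [IsProbabilityMeasure η] :
    ((η.prod (Measure.pi fun _ : Fin n => expMeasure 1)).prod
        (Measure.pi fun _ : Fin k => volume.restrict (Ioo (0 : ℝ) 1))).map
      chainStep
      = ((η.prod (stepLaw n k)).map fun p => p.1 + p.2).prod
        (Measure.pi fun _ : Fin n => expMeasure 1) := by
  have := isProbabilityMeasure_stepLaw hk hkn
  have hm : Measurable fun p : (Fin n → ℝ) × (Fin k → ℝ) =>
      (orderStat p.1 k, residual p.1 p.2) :=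
    ((measurable_orderStat k).comp measurable_fst).prodMk measurable_residual
  have hg : Measurable fun p : ℝ × (ℝ × (Fin n → ℝ)) => (p.1 + p.2.1, p.2.2) := by fun_prop
  have h1 : (chainStep : (ℝ × (Fin n → ℝ)) × (Fin k → ℝ) → ℝ × (Fin n → ℝ))
      = (fun p : ℝ × (ℝ × (Fin n → ℝ)) => (p.1 + p.2.1, p.2.2)) ∘
        (Prod.map id fun p : (Fin n → ℝ) × (Fin k → ℝ) => (orderStat p.1 k, residual p.1 p.2)) ∘
        MeasurableEquiv.prodAssoc := rfl
  rw [h1, ← Measure.map_map hg ((measurable_id.prodMap hm).comp (MeasurableEquiv.measurable _)),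
    ← Measure.map_map (measurable_id.prodMap hm) (MeasurableEquiv.measurable _),
    Measure.prodAssoc_prod, ← Measure.map_prod_map _ _ measurable_id hm, Measure.map_id,
    map_orderStat_residual hk hkn, ← Measure.prodAssoc_prod,
    Measure.map_map hg (MeasurableEquiv.measurable _)]
  have h2 : (fun p : ℝ × (ℝ × (Fin n → ℝ)) => (p.1 + p.2.1, p.2.2)) ∘
      (MeasurableEquiv.prodAssoc : (ℝ × ℝ) × (Fin n → ℝ) ≃ᵐ _)
      = Prod.map (fun p : ℝ × ℝ => p.1 + p.2) id := rfl
  rw [h2, ← Measure.map_prod_map _ _ (by fun_prop) measurable_id, Measure.map_id]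

section Law

variable {Ω : Type*} [MeasurableSpace Ω] {P : Measure Ω} [IsProbabilityMeasure P] {n k : ℕ}
  {x : ℝ} {ξ : Fin n → Ω → ℝ} {U : ℕ → Fin k → Ω → ℝ}

omit [IsProbabilityMeasure P] in
-- The state at time `j` is a function of the initial sample and of the rows of uniform variables
-- with index less than `j`; this block of the independent family is disjoint from row `j`.
lemma indepFun_excessChain (h : IsInput P (expMeasure 1) x ξ U) (hξ : ∀ i, Measurable (ξ i))
    (hU : ∀ j l, Measurable (U j l)) (j : ℕ) :
    IndepFun (fun ω => excessChain x (fun i => ξ i ω) (fun j l => U j l ω) j)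
      (fun ω l => U j l ω) P := by
  set f : Fin n ⊕ (ℕ × Fin k) → Ω → ℝ := Sum.elim ξ fun q => U q.1 q.2 with hf
  set m : Fin n ⊕ (ℕ × Fin k) → MeasurableSpace Ω := fun q =>
    MeasurableSpace.comap (f q) inferInstance with hm
  have hle : ∀ q, m q ≤ (inferInstance : MeasurableSpace Ω) := by
    rintro (i | q)
    · exact (hξ i).comap_le
    · exact (hU _ _).comap_le
  let S : ℕ → Set (Fin n ⊕ (ℕ × Fin k)) := fun j =>
    {q | Sum.elim (fun _ => True) (fun q : ℕ × Fin k => q.1 < j) q}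
  have hcoord : ∀ (T : Set (Fin n ⊕ (ℕ × Fin k))) q, q ∈ T → Measurable[⨆ i ∈ T, m i] (f q) :=
    fun T q hq => (comap_measurable (f q)).mono (le_iSup₂ (f := fun i (_ : i ∈ T) => m i) q hq)
      le_rfl
  have hSmono : ∀ j, (⨆ i ∈ S j, m i) ≤ ⨆ i ∈ S (j + 1), m i := by
    intro j
    refine biSup_mono ?_
    rintro (i | q) hq
    · trivial
    · exact Nat.lt_succ_of_lt hq
  have hchain : ∀ j, Measurable[⨆ i ∈ S j, m i]
      fun ω => excessChain x (fun i => ξ i ω) (fun j l => U j l ω) j := by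
    intro j
    induction j with
    | zero =>
      refine (@measurable_const _ _ _ (_) _).prodMk (@measurable_pi_lambda _ _ _ (_) _ _ fun i => ?_)
      exact (hcoord (S 0) (Sum.inl i) trivial).sub_const x
    | succ j ih =>
      have ih' := ih.mono (hSmono j) le_rfl
      have hUj : Measurable[⨆ i ∈ S (j + 1), m i] fun ω l => U j l ω :=
        @measurable_pi_lambda _ _ _ (_) _ _ fun l =>
          hcoord (S (j + 1)) (Sum.inr (j, l)) (Nat.lt_succ_self j)
      exact measurable_chainStep.comp (ih'.prodMk hUj)
  have hd : Disjoint (S j) {q | Sum.elim (fun _ => False) (fun q : ℕ × Fin k => q.1 = j) q} := by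
    rw [Set.disjoint_left]
    rintro (i | q) h1 h2
    · exact h2
    · exact (ne_of_lt h1) h2
  have hind := indep_iSup_of_disjoint hle (show iIndep m P from h.indep) hd
  rw [IndepFun_iff_Indep]
  refine indep_of_indep_of_le_left (indep_of_indep_of_le_right hind ?_) (hchain j).comap_le
  refine Measurable.comap_le (@measurable_pi_lambda _ _ _ (_) _ _ fun l => ?_)
  exact hcoord _ (Sum.inr (j, l)) rfl

lemma measurable_excessChain (hξ : ∀ i, Measurable (ξ i))
    (hU : ∀ j l, Measurable (U j l)) (j : ℕ) :
    Measurable fun ω => excessChain x (fun i => ξ i ω) (fun j l => U j l ω) j := by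
  induction j with
  | zero =>
    exact measurable_const.prodMk (measurable_pi_lambda _ fun i => (hξ i).sub_const x)
  | succ j ih =>
    exact measurable_chainStep.comp (ih.prodMk (measurable_pi_lambda _ fun l => hU j l))

theorem map_excessChain (hk : 1 ≤ k) (hkn : k ≤ n) (hx : 0 ≤ x)
    (h : IsInput P (expMeasure 1) x ξ U) (hξ : ∀ i, Measurable (ξ i))
    (hU : ∀ j l, Measurable (U j l)) (j : ℕ) :
    P.map (fun ω => excessChain x (fun i => ξ i ω) (fun j l => U j l ω) j)
      = (levelLaw n k x j).prod (Measure.pi fun _ => expMeasure 1) := by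
  induction j with
  | zero =>
    have h1 : iIndepFun (fun i ω => ξ i ω - x) P := by
      have := h.indep.precomp Sum.inl_injective
      exact this.comp (fun _ t => t - x) fun _ => by fun_prop
    have h2 := (iIndepFun_iff_map_fun_eq_pi_map
      (fun i => ((hξ i).sub_const x).aemeasurable)).1 h1
    have h3 : ∀ i, P.map (fun ω => ξ i ω - x) = expMeasure 1 := by
      intro i
      have : (fun ω => ξ i ω - x) = (fun t => t - x) ∘ ξ i := rfl
      rw [this, ← Measure.map_map (by fun_prop) (hξ i), (h.law_init i).map_eq,
        cond_expMeasure_eq_map hx, Measure.map_map (by fun_prop) (by fun_prop)]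
      convert Measure.map_id
      ext t; simp
    simp only [h3] at h2
    rw [levelLaw, Measure.dirac_prod, ← h2, Measure.map_map (by fun_prop)
      (measurable_pi_lambda _ fun i => (hξ i).sub_const x)]
    rfl
  | succ j ih =>
    have := isProbabilityMeasure_levelLaw hk hkn x j
    have hUj : Measurable fun ω l => U j l ω := measurable_pi_lambda _ fun l => hU j l
    have hc := measurable_excessChain (x := x) hξ hU j
    have h1 := (indepFun_iff_map_prod_eq_prod_map_map hc.aemeasurable hUj.aemeasurable).1
      (indepFun_excessChain h hξ hU j)
    have h2 : P.map (fun ω l => U j l ω)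
        = Measure.pi fun _ : Fin k => volume.restrict (Ioo (0 : ℝ) 1) := by
      have h3 : iIndepFun (fun l => U j l) P :=
        h.indep.precomp (g := fun l => Sum.inr (j, l)) fun l l' hl => by simpa using hl
      have h4 := (iIndepFun_iff_map_fun_eq_pi_map (fun l => (hU j l).aemeasurable)).1 h3
      rw [h4]
      congr 1
      ext1 l
      exact (h.law_unif j l).map_eq
    rw [ih, h2] at h1
    rw [levelLaw, ← map_step hk hkn, ← h1,
      Measure.map_map measurable_chainStep (hc.prodMk hUj)]
    rfl

end Law

/-! ### Renewal series: equation and convergence. -/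

/-- `g ↦ (y ↦ 𝔼[g(y + Z)])`, where `Z` has the law `stepLaw n k`. -/
noncomputable def renewalOp (n k : ℕ) (g : ℝ → ℝ≥0∞) (y : ℝ) : ℝ≥0∞ :=
  ∫⁻ t, g (y + t) ∂stepLaw n k

/-- The solution `∑ ρ^j L^j g` of the renewal equation `W = g + ρ L W`. -/
noncomputable def renewalSum (n k : ℕ) (ρ : ℝ≥0∞) (g : ℝ → ℝ≥0∞) (y : ℝ) : ℝ≥0∞ :=
  ∑' j : ℕ, ρ ^ j * (renewalOp n k)^[j] g y

lemma measurable_renewalOp (n k : ℕ) {g : ℝ → ℝ≥0∞} (hg : Measurable g) :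
    Measurable (renewalOp n k g) := by
  unfold renewalOp
  exact Measurable.lintegral_prod_right' (f := fun p : ℝ × ℝ => g (p.1 + p.2)) (by fun_prop)

lemma measurable_iterate_renewalOp (n k : ℕ) {g : ℝ → ℝ≥0∞} (hg : Measurable g) (j : ℕ) :
    Measurable ((renewalOp n k)^[j] g) := by
  induction j with
  | zero => exact hg
  | succ j ih => rw [Function.iterate_succ_apply']; exact measurable_renewalOp n k ih

lemma measurable_renewalSum (n k : ℕ) (ρ : ℝ≥0∞) {g : ℝ → ℝ≥0∞} (hg : Measurable g) :
    Measurable (renewalSum n k ρ g) :=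
  Measurable.tsum fun j => (measurable_iterate_renewalOp n k hg j).const_mul _

/-- Integrating out the last step replaces `g` by `renewalOp n k g`, hence the induction over all
`g` at once. -/
lemma lintegral_levelLaw {n k : ℕ} (x : ℝ) (j : ℕ) {g : ℝ → ℝ≥0∞} (hg : Measurable g) :
    ∫⁻ y, g y ∂levelLaw n k x j = (renewalOp n k)^[j] g x := by
  induction j generalizing g with
  | zero => rw [levelLaw, lintegral_dirac' _ hg]; rfl
  | succ j ih =>
    rw [levelLaw, lintegral_map hg (by fun_prop), lintegral_prod _ (by fun_prop),
      Function.iterate_succ_apply, ← ih (measurable_renewalOp n k hg)]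
    rfl

lemma renewalSum_eq (n k : ℕ) (ρ : ℝ≥0∞) {g : ℝ → ℝ≥0∞} (hg : Measurable g) (y : ℝ) :
    renewalSum n k ρ g y = g y + ρ * renewalOp n k (renewalSum n k ρ g) y := by
  have h : renewalOp n k (renewalSum n k ρ g) y
      = ∑' j : ℕ, ρ ^ j * (renewalOp n k)^[j + 1] g y := by
    unfold renewalSum
    rw [renewalOp, lintegral_tsum fun j => by
      have := measurable_iterate_renewalOp n k hg j
      fun_prop]
    refine tsum_congr fun j => ?_
    have hj : Measurable fun t => (renewalOp n k)^[j] g (y + t) :=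
      (measurable_iterate_renewalOp n k hg j).comp (by fun_prop)
    rw [lintegral_const_mul _ hj, Function.iterate_succ_apply', renewalOp]
  rw [h, renewalSum, tsum_eq_zero_add' ENNReal.summable, ← ENNReal.tsum_mul_left]
  simp only [pow_zero, one_mul, Function.iterate_zero, id_eq, ← mul_assoc, pow_succ']

lemma renewalOp_mono {n k : ℕ} {g h : ℝ → ℝ≥0∞} (hgh : g ≤ h) :
    renewalOp n k g ≤ renewalOp n k h := fun _ => lintegral_mono fun _ => hgh _

lemma ae_stepLaw_pos (n k : ℕ) : ∀ᵐ t ∂stepLaw n k, 0 < t :=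
  (withDensity_absolutelyContinuous _ _).ae_le ae_expMeasure_pos

/-- The Laplace transform at `1` of the law `stepLaw n k`. -/
noncomputable def stepLaplace (n k : ℕ) : ℝ≥0∞ := ∫⁻ t, ENNReal.ofReal (Real.exp (-t)) ∂stepLaw n k

lemma stepLaplace_lt_one {n k : ℕ} (hk : 1 ≤ k) (hkn : k ≤ n) : stepLaplace n k < 1 := by
  have := isProbabilityMeasure_stepLaw hk hkn
  have hlt : ∀ᵐ t ∂stepLaw n k, ENNReal.ofReal (Real.exp (-t)) < 1 := by
    filter_upwards [ae_stepLaw_pos n k] with t ht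
    rw [← ENNReal.ofReal_one]
    exact (ENNReal.ofReal_lt_ofReal_iff one_pos).2 (by simpa using ht)
  have h1 : ∫⁻ _ : ℝ, (1 : ℝ≥0∞) ∂stepLaw n k = 1 := by simp
  unfold stepLaplace
  rw [← h1]
  refine lintegral_strict_mono (IsProbabilityMeasure.ne_zero _) measurable_const.aemeasurable
    (ne_of_lt ?_) hlt
  refine lt_of_le_of_lt (lintegral_mono_ae (hlt.mono fun t ht => ht.le)) ?_
  rw [h1]; exact ENNReal.one_lt_top

/-- The function `y ↦ e^{a-y}` is an eigenfunction of `renewalOp n k` with eigenvalue `stepLaplace n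
k`. The resulting geometric decay gives convergence even for `ρ = 1`, the case of `T`. -/
lemma iterate_renewalOp_le {n k : ℕ} {a : ℝ} {g : ℝ → ℝ≥0∞}
    (hg : ∀ y, g y ≤ ENNReal.ofReal (Real.exp (a - y))) (j : ℕ) (y : ℝ) :
    (renewalOp n k)^[j] g y ≤ stepLaplace n k ^ j * ENNReal.ofReal (Real.exp (a - y)) := by
  induction j generalizing y with
  | zero => simpa using hg y
  | succ j ih =>
    rw [Function.iterate_succ_apply']
    refine (renewalOp_mono (h := fun y => stepLaplace n k ^ j * ENNReal.ofReal (Real.exp (a - y)))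
      (fun y => ih y) y).trans (le_of_eq ?_)
    have : ∀ t, stepLaplace n k ^ j * ENNReal.ofReal (Real.exp (a - (y + t)))
        = (stepLaplace n k ^ j * ENNReal.ofReal (Real.exp (a - y)))
          * ENNReal.ofReal (Real.exp (-t)) := by
      intro t
      rw [mul_assoc, ← ENNReal.ofReal_mul (Real.exp_pos _).le, ← Real.exp_add]
      ring_nf
    simp only [renewalOp, this]
    rw [lintegral_const_mul _ (by fun_prop), ← stepLaplace]
    ring

lemma renewalSum_le {n k : ℕ} {a : ℝ} {ρ : ℝ≥0∞} (hρ : ρ ≤ 1) {g : ℝ → ℝ≥0∞}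
    (hg : ∀ y, g y ≤ ENNReal.ofReal (Real.exp (a - y))) (y : ℝ) :
    renewalSum n k ρ g y ≤ (1 - stepLaplace n k)⁻¹ * ENNReal.ofReal (Real.exp (a - y)) := by
  rw [← ENNReal.tsum_geometric, ← ENNReal.tsum_mul_right]
  refine ENNReal.tsum_le_tsum fun j => ?_
  calc ρ ^ j * (renewalOp n k)^[j] g y ≤ 1 * (renewalOp n k)^[j] g y :=
        mul_le_mul_left (pow_le_one' hρ j) _
    _ ≤ _ := by rw [one_mul]; exact iterate_renewalOp_le hg j y

lemma renewalSum_eq_zero {n k : ℕ} {a : ℝ} {ρ : ℝ≥0∞} {g : ℝ → ℝ≥0∞}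
    (hg : ∀ y, a < y → g y = 0) {y : ℝ} (hy : a < y) : renewalSum n k ρ g y = 0 := by
  have h : ∀ j : ℕ, ∀ y, a < y → (renewalOp n k)^[j] g y = 0 := by
    intro j
    induction j with
    | zero => exact hg
    | succ j ih =>
      intro y hy
      rw [Function.iterate_succ_apply', renewalOp]
      refine (lintegral_congr_ae ?_).trans lintegral_zero
      filter_upwards [ae_stepLaw_pos n k] with t ht using ih _ (by linarith)
  simp [renewalSum, h _ y hy]

/-- The step law has no atoms. Index `0` is excluded, since the starting level may be `a`. -/
lemma levelLaw_succ_singleton (n k : ℕ) (x a : ℝ) (j : ℕ) : levelLaw n k x (j + 1) {a} = 0 := by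
  have hm : Measurable fun p : ℝ × ℝ => p.1 + p.2 := by fun_prop
  rw [levelLaw, Measure.map_apply hm (measurableSet_singleton a),
    Measure.prod_apply (hm (measurableSet_singleton a))]
  refine (lintegral_congr fun y => ?_).trans lintegral_zero
  have : Prod.mk y ⁻¹' ((fun p : ℝ × ℝ => p.1 + p.2) ⁻¹' {a}) = {a - y} := by
    ext t; simp [eq_sub_iff_add_eq']
  rw [this]
  exact withDensity_absolutelyContinuous _ _ (expMeasure_singleton _)

/-- The function `y ↦ Q(e^{y-a})` on `(-∞, a]`, continued by `0`. -/
noncomputable def cutoff (a : ℝ) (Q : ℝ[X]) (y : ℝ) : ℝ≥0∞ :=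
  if y ≤ a then ENNReal.ofReal (Q.eval (Real.exp (y - a))) else 0

lemma measurable_cutoff (a : ℝ) (Q : ℝ[X]) : Measurable (cutoff a Q) := by
  refine Measurable.ite measurableSet_Iic ?_ measurable_const
  have h : Continuous fun y : ℝ => Q.eval (Real.exp (y - a)) := Q.continuous.comp (by fun_prop)
  exact h.measurable.ennreal_ofReal

lemma cutoff_le {a : ℝ} {Q : ℝ[X]} (hQ : ∀ q ∈ Icc (0 : ℝ) 1, Q.eval q ≤ 1) (y : ℝ) :
    cutoff a Q y ≤ ENNReal.ofReal (Real.exp (a - y)) := by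
  rw [cutoff]
  split_ifs with h
  · refine ENNReal.ofReal_le_ofReal ((hQ _ ⟨(Real.exp_pos _).le, ?_⟩).trans ?_)
    · rw [Real.exp_le_one_iff]; linarith
    · rw [Real.one_le_exp_iff]; linarith
  · exact zero_le

/-! ### The contribution of the final configuration. -/

/-- The polynomial `q ↦ 𝔼[(B/n)^s; B > n - k]`, where `B` is binomial with parameters `n`, `q`. -/
noncomputable def tailMoment (n k s : ℕ) : ℝ[X] :=
  ∑ b ∈ Finset.Icc (n - k + 1) n,
    Polynomial.C (((b : ℝ) / n) ^ s * n.choose b) * Polynomial.X ^ b * (1 - Polynomial.X) ^ (n - b)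

lemma tailMoment_eval (n k s : ℕ) (q : ℝ) : (tailMoment n k s).eval q
    = ∑ b ∈ Finset.Icc (n - k + 1) n, ((b : ℝ) / n) ^ s * n.choose b * q ^ b * (1 - q) ^ (n - b) := by
  simp [tailMoment, Polynomial.eval_finsetSum]

lemma tailMoment_nonneg (n k s : ℕ) {q : ℝ} (hq : q ∈ Icc (0 : ℝ) 1) :
    0 ≤ (tailMoment n k s).eval q := by
  rw [tailMoment_eval]
  have h1 := hq.1
  have h2 : 0 ≤ 1 - q := by linarith [hq.2]
  exact Finset.sum_nonneg fun b _ => by positivity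

lemma tailMoment_le_one (n k s : ℕ) {q : ℝ} (hq : q ∈ Icc (0 : ℝ) 1) :
    (tailMoment n k s).eval q ≤ 1 := by
  rw [tailMoment_eval]
  have h1 := hq.1
  have h2 : 0 ≤ 1 - q := by linarith [hq.2]
  calc _ ≤ ∑ b ∈ Finset.Icc (n - k + 1) n, q ^ b * (1 - q) ^ (n - b) * n.choose b := by
        refine Finset.sum_le_sum fun b hb => ?_
        have hb' : (b : ℝ) ≤ n := by exact_mod_cast (Finset.mem_Icc.1 hb).2
        have h3 : ((b : ℝ) / n) ^ s ≤ 1 := pow_le_one₀ (by positivity)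
          (div_le_one_of_le₀ hb' (by positivity))
        have h4 : 0 ≤ q ^ b * (1 - q) ^ (n - b) * n.choose b := by positivity
        nlinarith
    _ ≤ ∑ b ∈ Finset.range (n + 1), q ^ b * (1 - q) ^ (n - b) * n.choose b := by
        refine Finset.sum_le_sum_of_subset_of_nonneg ?_ fun b _ _ => by positivity
        intro b hb
        simp only [Finset.mem_Icc, Finset.mem_range] at hb ⊢; omega
    _ = 1 := by rw [← add_pow]; ring

lemma le_orderStat_iff {n k : ℕ} (hk : 1 ≤ k) (hkn : k ≤ n) (e : Fin n → ℝ) (t : ℝ) :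
    t ≤ orderStat e k ↔ n - k + 1 ≤ (Finset.univ.filter fun i => t ≤ e i).card := by
  set σ := Tuple.sort e with hσ
  set m : Fin n := ⟨k - 1, by omega⟩ with hm
  have hmono : Monotone (e ∘ σ) := Tuple.monotone_sort e
  rw [orderStat_eq hk hkn, ← hσ, ← hm]
  have hc : (Finset.univ.filter fun i => t ≤ e i).card
      = (Finset.univ.filter fun i => t ≤ e (σ i)).card := by
    refine (Finset.card_bij (fun i _ => σ i) ?_ ?_ ?_).symm
    · intro i hi; simpa using hi
    · intro i _ j _ h; simpa using h
    · intro i hi; exact ⟨σ.symm i, by simpa using hi, by simp⟩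
  rw [hc]
  constructor
  · intro h
    have hsub : Finset.Ici m ⊆ Finset.univ.filter fun i => t ≤ e (σ i) := by
      intro i hi
      simp only [Finset.mem_filter, Finset.mem_univ, true_and]
      exact h.trans (hmono (Finset.mem_Ici.1 hi))
    have := Finset.card_le_card hsub
    rw [Fin.card_Ici] at this
    simp only [hm] at this
    omega
  · intro h
    by_contra hlt
    have hsub : (Finset.univ.filter fun i => t ≤ e (σ i)) ⊆ Finset.Ioi m := by
      intro i hi
      simp only [Finset.mem_filter, Finset.mem_univ, true_and] at hi
      rw [Finset.mem_Ioi]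
      by_contra hi'
      exact hlt (hi.trans (hmono (not_lt.1 hi')))
    have := Finset.card_le_card hsub
    rw [Fin.card_Ioi] at this
    simp only [hm] at this
    omega

/-- The contribution to the `s`-th power of the estimator of a final configuration with level `y`
and excesses `e`. -/
noncomputable def terminalValue {n : ℕ} (k s : ℕ) (a : ℝ) (p : ℝ × (Fin n → ℝ)) : ℝ≥0∞ :=
  if a ≤ p.1 + orderStat p.2 k then
    ENNReal.ofReal (((Finset.univ.filter fun i => a ≤ p.1 + p.2 i).card / (n : ℝ)) ^ s) else 0

/-- Partition by the set `S` of particles at or above `a`: each piece is a box in the excesses, and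
the stopping condition depends on `S.card` alone. -/
lemma terminalValue_eq_sum {n k : ℕ} (hk : 1 ≤ k) (hkn : k ≤ n) (s : ℕ) (a : ℝ)
    (p : ℝ × (Fin n → ℝ)) :
    terminalValue k s a p = ∑ S : Finset (Fin n),
      {p : ℝ × (Fin n → ℝ) | p.2 ∈ univ.pi fun i => if i ∈ S then Ici (a - p.1) else
        Iio (a - p.1)}.indicator (fun _ => if n - k + 1 ≤ S.card then
          ENNReal.ofReal ((S.card / (n : ℝ)) ^ s) else 0) p := by
  classical
  have h1 : a ≤ p.1 + orderStat p.2 k ↔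
      n - k + 1 ≤ (Finset.univ.filter fun i => a ≤ p.1 + p.2 i).card := by
    rw [← sub_le_iff_le_add', le_orderStat_iff hk hkn]
    simp only [sub_le_iff_le_add']
  have h2 : ∀ S : Finset (Fin n), (p.2 ∈ univ.pi fun i => if i ∈ S then Ici (a - p.1) else
        Iio (a - p.1)) ↔ S = Finset.univ.filter fun i => a ≤ p.1 + p.2 i := by
    intro S
    simp only [mem_univ_pi, Finset.ext_iff, Finset.mem_filter, Finset.mem_univ, true_and]
    refine forall_congr' fun i => ?_
    by_cases hi : i ∈ S
    · simp [hi, add_comm]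
    · simp [hi, lt_sub_iff_add_lt']
  rw [Finset.sum_eq_single (Finset.univ.filter fun i => a ≤ p.1 + p.2 i)]
  · rw [indicator_of_mem (by rw [mem_ofPred_eq, h2])]
    simp only [terminalValue, h1]
  · intro S _ hS
    refine indicator_of_notMem ?_ _
    rw [mem_ofPred_eq, h2]; exact hS
  · simp

lemma measurable_terminalValue {n k : ℕ} (hk : 1 ≤ k) (hkn : k ≤ n) (s : ℕ) (a : ℝ) :
    Measurable (terminalValue k s a : ℝ × (Fin n → ℝ) → ℝ≥0∞) := by
  have : (terminalValue k s a : ℝ × (Fin n → ℝ) → ℝ≥0∞) = fun p => _ :=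
    funext fun p => terminalValue_eq_sum hk hkn s a p
  rw [this]
  refine Finset.measurable_sum _ fun S _ => measurable_const.indicator ?_
  simp only [mem_univ_pi, ofPred_forall]
  refine .iInter fun i => ?_
  have hi : Measurable fun p : ℝ × (Fin n → ℝ) => p.2 i :=
    (measurable_pi_apply i).comp measurable_snd
  split_ifs
  · exact measurableSet_le (measurable_fst.const_sub a) hi
  · exact measurableSet_lt hi (measurable_fst.const_sub a)

lemma expMeasure_Ici {z : ℝ} (hz : 0 ≤ z) :
    expMeasure 1 (Ici z) = ENNReal.ofReal (Real.exp (-z)) := by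
  rw [← expMeasure_Ioi hz, ← Ioi_insert, insert_eq]
  refine le_antisymm ((measure_union_le _ _).trans ?_) (measure_mono subset_union_right)
  rw [expMeasure_singleton, zero_add]

lemma expMeasure_Iio {z : ℝ} (hz : 0 ≤ z) :
    expMeasure 1 (Iio z) = ENNReal.ofReal (1 - Real.exp (-z)) := by
  rw [← expMeasure_Iic hz, ← Iio_insert, insert_eq]
  refine le_antisymm (measure_mono subset_union_right) ((measure_union_le _ _).trans ?_)
  rw [expMeasure_singleton, zero_add]

/-- Each particle lies at or above `a` independently with probability `e^{y-a}`, so their number is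
binomial. -/
lemma lintegral_terminalValue {n k : ℕ} (hk : 1 ≤ k) (hkn : k ≤ n) (s : ℕ) {a y : ℝ}
    (hy : y ≤ a) :
    ∫⁻ e, terminalValue k s a (y, e) ∂(Measure.pi fun _ : Fin n => expMeasure 1)
      = ENNReal.ofReal ((tailMoment n k s).eval (Real.exp (y - a))) := by
  classical
  set q := Real.exp (y - a) with hq
  have hq0 : 0 ≤ q := (Real.exp_pos _).le
  have hq1 : 0 ≤ 1 - q := by rw [sub_nonneg, hq, Real.exp_le_one_iff]; linarith
  have hay : 0 ≤ a - y := by linarith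
  have hbox : ∀ S : Finset (Fin n), MeasurableSet
      (univ.pi fun i => if i ∈ S then Ici (a - y) else Iio (a - y)) := fun S =>
    MeasurableSet.univ_pi fun i => by
      split_ifs
      · exact measurableSet_Ici
      · exact measurableSet_Iio
  have h1 : ∀ e : Fin n → ℝ, terminalValue k s a (y, e) = ∑ S : Finset (Fin n),
      (univ.pi fun i => if i ∈ S then Ici (a - y) else Iio (a - y)).indicator
        (fun _ => if n - k + 1 ≤ S.card then
          ENNReal.ofReal ((S.card / (n : ℝ)) ^ s) else 0) e := fun e =>
    terminalValue_eq_sum hk hkn s a (y, e)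
  simp only [h1]
  rw [lintegral_finsetSum _ fun S _ => measurable_const.indicator (hbox S)]
  have h2 : ∀ S : Finset (Fin n), ∫⁻ e,
      (univ.pi fun i => if i ∈ S then Ici (a - y) else Iio (a - y)).indicator
        (fun _ => if n - k + 1 ≤ S.card then
          ENNReal.ofReal ((S.card / (n : ℝ)) ^ s) else 0) e
        ∂(Measure.pi fun _ : Fin n => expMeasure 1)
      = ENNReal.ofReal (if n - k + 1 ≤ S.card then
          ((S.card : ℝ) / n) ^ s * (q ^ S.card * (1 - q) ^ (n - S.card)) else 0) := by
    intro S
    rw [lintegral_indicator_const (hbox S), Measure.pi_pi]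
    have h3 : ∏ i, expMeasure 1 (if i ∈ S then Ici (a - y) else Iio (a - y))
        = ENNReal.ofReal (q ^ S.card * (1 - q) ^ (n - S.card)) := by
      rw [← Finset.prod_mul_prod_compl S, ENNReal.ofReal_mul (by positivity),
        ENNReal.ofReal_pow hq0, ENNReal.ofReal_pow hq1]
      congr 1
      · refine Finset.prod_eq_pow_card fun i hi => ?_
        rw [if_pos hi, expMeasure_Ici hay, hq, neg_sub]
      · have : (Sᶜ).card = n - S.card := by rw [Finset.card_compl, Fintype.card_fin]
        rw [← this]
        refine Finset.prod_eq_pow_card fun i hi => ?_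
        rw [if_neg (Finset.mem_compl.1 hi), expMeasure_Iio hay, hq, neg_sub]
    rw [h3]
    split_ifs
    · rw [← ENNReal.ofReal_mul (by positivity)]
    · simp
  simp only [h2]
  rw [← ENNReal.ofReal_sum_of_nonneg fun S _ => by split_ifs <;> positivity]
  congr 1
  have h4 := Finset.sum_powerset_apply_card (fun m : ℕ => if n - k + 1 ≤ m then
          ((m : ℝ) / n) ^ s * (q ^ m * (1 - q) ^ (n - m)) else 0)
    (x := (Finset.univ : Finset (Fin n)))
  rw [Finset.powerset_univ, Finset.card_univ, Fintype.card_fin] at h4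
  rw [h4, tailMoment_eval]
  have h5 : Finset.Icc (n - k + 1) n = (Finset.range (n + 1)).filter fun m => n - k + 1 ≤ m := by
    ext m; simp only [Finset.mem_Icc, Finset.mem_filter, Finset.mem_range]; omega
  rw [h5, Finset.sum_filter]
  refine Finset.sum_congr rfl fun m _ => ?_
  split_ifs
  · rw [nsmul_eq_mul]; ring
  · simp

/-! ### Deterministic facts on the first crossing of `a`. -/

section Hitting

variable {z : ℕ → ℝ} (hz : Monotone z) {a : ℝ} (h0 : z 0 ≤ a) (hne : ∀ j, z (j + 1) ≠ a)
  (hex : ∃ j, a ≤ z (j + 1))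

include hz h0 hne hex in
lemma le_iff_le_hitting (j : ℕ) : z j ≤ a ↔ j ≤ sInf {j : ℕ | a ≤ z (j + 1)} := by
  have hmem : a ≤ z (sInf {j : ℕ | a ≤ z (j + 1)} + 1) := Nat.sInf_mem hex
  constructor
  · intro h
    by_contra hlt
    push Not at hlt
    obtain ⟨i, rfl⟩ : ∃ i, j = i + 1 := ⟨j - 1, by omega⟩
    exact hne i (le_antisymm h (hmem.trans (hz (by omega))))
  · intro h
    cases j with
    | zero => exact h0
    | succ j =>
      have : j ∉ {j : ℕ | a ≤ z (j + 1)} := Nat.notMem_of_lt_sInf (by omega)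
      simp only [mem_ofPred_eq, not_le] at this
      exact this.le

include hz h0 hne hex in
lemma crossing_iff_eq_hitting (j : ℕ) :
    z j ≤ a ∧ a ≤ z (j + 1) ↔ j = sInf {j : ℕ | a ≤ z (j + 1)} := by
  rw [le_iff_le_hitting hz h0 hne hex]
  constructor
  · rintro ⟨h1, h2⟩
    exact le_antisymm h1 (Nat.sInf_le h2)
  · rintro rfl
    exact ⟨le_rfl, Nat.sInf_mem hex⟩

include hz h0 hne hex in
-- The levels that are at most `a` are those of index `0, …, J`; this is where the extra one in `T`
-- comes from.
lemma hitting_add_one_eq_tsum :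
    ((sInf {j : ℕ | a ≤ z (j + 1)} : ℕ) : ℝ≥0∞) + 1
      = ∑' j, (Iic a).indicator (fun _ => (1 : ℝ≥0∞)) (z j) := by
  rw [tsum_eq_sum (s := Finset.range (sInf {j : ℕ | a ≤ z (j + 1)} + 1))]
  · rw [Finset.sum_congr rfl (g := fun _ => 1)]
    · simp
    · intro j hj
      refine indicator_of_mem ?_ _
      rw [mem_Iic, le_iff_le_hitting hz h0 hne hex]
      exact Nat.lt_succ_iff.1 (Finset.mem_range.1 hj)
  · intro j hj
    refine indicator_of_notMem ?_ _
    rw [mem_Iic, le_iff_le_hitting hz h0 hne hex]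
    simpa using hj

end Hitting

lemma cutoff_one (a y : ℝ) : cutoff a 1 y = (Iic a).indicator (fun _ => 1) y := by
  simp [cutoff, indicator_apply]

lemma renewalSum_lt_top {n k : ℕ} (hk : 1 ≤ k) (hkn : k ≤ n) {a : ℝ} {ρ : ℝ≥0∞} (hρ : ρ ≤ 1) {Q : ℝ[X]}
    (hQ : ∀ q ∈ Icc (0 : ℝ) 1, Q.eval q ≤ 1) (y : ℝ) : renewalSum n k ρ (cutoff a Q) y < ∞ := by
  refine (renewalSum_le hρ (cutoff_le hQ) y).trans_lt (ENNReal.mul_lt_top ?_ ENNReal.ofReal_lt_top)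
  rw [ENNReal.inv_lt_top, tsub_pos_iff_lt]
  exact stepLaplace_lt_one hk hkn

/-! ### The three expectations as renewal series. -/

section Expectation

variable {Ω : Type*} [MeasurableSpace Ω] {P : Measure Ω} [IsProbabilityMeasure P] {n k : ℕ}
  {a x : ℝ} {ξ : Fin n → Ω → ℝ} {U : ℕ → Fin k → Ω → ℝ}

omit [IsProbabilityMeasure P] in
lemma IsInput.ae_unif_mem (h : IsInput P (expMeasure 1) x ξ U) :
    ∀ᵐ ω ∂P, ∀ j l, U j l ω ∈ Ioo (0 : ℝ) 1 := by
  rw [ae_all_iff]; intro j; rw [ae_all_iff]; intro l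
  refine ae_of_ae_map (h.law_unif j l).aemeasurable ?_
  rw [(h.law_unif j l).map_eq]
  exact ae_restrict_mem measurableSet_Ioo

omit [IsProbabilityMeasure P] in
lemma IsInput.ae_init_mem (h : IsInput P (expMeasure 1) x ξ U) : ∀ᵐ ω ∂P, ∀ i, x ≤ ξ i ω := by
  rw [ae_all_iff]; intro i
  refine ae_of_ae_map (h.law_init i).aemeasurable ?_
  rw [(h.law_init i).map_eq]
  filter_upwards [ae_cond_mem (μ := expMeasure 1) (measurableSet_Ioi (a := x))] with t ht
  exact le_of_lt ht

section Measurable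

variable (hk : 1 ≤ k) (hkn : k ≤ n) (hx : x ∈ Icc 0 a)
  (h : IsInput P (expMeasure 1) x ξ U) (hξ : ∀ i, Measurable (ξ i))
  (hU : ∀ j l, Measurable (U j l))

include hk hkn hx h hξ hU

lemma lintegral_excessChain (j : ℕ) {G : ℝ × (Fin n → ℝ) → ℝ≥0∞} (hG : Measurable G) :
    ∫⁻ ω, G (excessChain x (fun i => ξ i ω) (fun j l => U j l ω) j) ∂P
      = ∫⁻ y, ∫⁻ e, G (y, e) ∂(Measure.pi fun _ => expMeasure 1) ∂levelLaw n k x j := by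
  have := isProbabilityMeasure_levelLaw hk hkn x j
  rw [← lintegral_map hG (measurable_excessChain hξ hU j), map_excessChain hk hkn hx.1 h hξ hU,
    lintegral_prod _ hG.aemeasurable]

lemma ae_level_ne (j : ℕ) :
    ∀ᵐ ω ∂P, (excessChain x (fun i => ξ i ω) (fun j l => U j l ω) (j + 1)).1 ≠ a := by
  have hs : MeasurableSet {p : ℝ × (Fin n → ℝ) | p.1 = a} :=
    measurable_fst (measurableSet_singleton a)
  have h1 := congrArg (fun m => m {p | p.1 = a}) (map_excessChain hk hkn hx.1 h hξ hU (j + 1))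
  have h2 : {p : ℝ × (Fin n → ℝ) | p.1 = a} = {a} ×ˢ univ := by ext p; simp
  rw [Measure.map_apply (measurable_excessChain hξ hU _) hs, h2, Measure.prod_prod,
    levelLaw_succ_singleton, zero_mul] at h1
  rw [ae_iff]
  refine measure_mono_null (fun ω hω => ?_) h1
  simpa using hω

lemma lintegral_tsum_indicator :
    ∫⁻ ω, ∑' j, (Iic a).indicator (fun _ => (1 : ℝ≥0∞))
      (excessChain x (fun i => ξ i ω) (fun j l => U j l ω) j).1 ∂P
      = renewalSum n k 1 (cutoff a 1) x := by
  have hG : Measurable fun p : ℝ × (Fin n → ℝ) => cutoff a 1 p.1 :=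
    (measurable_cutoff a 1).comp measurable_fst
  simp only [← cutoff_one]
  have hGj : ∀ j, Measurable fun ω =>
      cutoff a 1 (excessChain x (fun i => ξ i ω) (fun j l => U j l ω) j).1 := fun j =>
    hG.comp (measurable_excessChain hξ hU j)
  rw [lintegral_tsum fun j => (hGj j).aemeasurable, renewalSum]
  refine tsum_congr fun j => ?_
  rw [lintegral_excessChain hk hkn hx h hξ hU j hG, one_pow, one_mul,
    ← lintegral_levelLaw x j (measurable_cutoff a 1)]
  simp

/-- If no level reached `a`, the number of levels at most `a` would be infinite, but its expectation
is finite. -/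
lemma ae_exists_level_ge : ∀ᵐ ω ∂P,
    ∃ j, a ≤ (excessChain x (fun i => ξ i ω) (fun j l => U j l ω) (j + 1)).1 := by
  have h1 := lintegral_tsum_indicator hk hkn hx h hξ hU
  have h2 : ∀ᵐ ω ∂P, ∑' j, (Iic a).indicator (fun _ => (1 : ℝ≥0∞))
      (excessChain x (fun i => ξ i ω) (fun j l => U j l ω) j).1 < ∞ := by
    refine ae_lt_top ?_ ?_
    · refine Measurable.tsum fun j => ?_
      exact (measurable_const.indicator measurableSet_Iic).comp
        (measurable_fst.comp (measurable_excessChain hξ hU j))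
    · rw [h1]
      exact (renewalSum_lt_top hk hkn le_rfl (by simp) x).ne
  filter_upwards [h2] with ω hω
  by_contra hcon
  push Not at hcon
  refine hω.ne ?_
  rw [← ENNReal.tsum_const_eq_top_of_ne_zero (α := ℕ) one_ne_zero]
  refine tsum_congr fun j => indicator_of_mem ?_ _
  cases j with
  | zero => exact hx.2
  | succ j => exact (hcon j).le

/-- The condition inside `terminalValue` says that the next level is at least `a`, so together with
the indicator it selects `j = J`. This turns quantities evaluated at the random time `J` into sums
over deterministic times, where the law of the chain is known. -/
lemma ae_eq_tsum : ∀ᵐ ω ∂P,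
    (∃ j, a ≤ level (expMeasure 1) x (fun i => ξ i ω) (fun j l => U j l ω) (j + 1)) ∧
    ((iterations (expMeasure 1) a x (fun i => ξ i ω) (fun j l => U j l ω) : ℝ≥0∞) + 1
      = ∑' j, (Iic a).indicator (fun _ => (1 : ℝ≥0∞))
        (excessChain x (fun i => ξ i ω) (fun j l => U j l ω) j).1) ∧
    0 ≤ estimator (expMeasure 1) a x (fun i => ξ i ω) (fun j l => U j l ω) ∧
    ∀ s : ℕ, ENNReal.ofReal
      (estimator (expMeasure 1) a x (fun i => ξ i ω) (fun j l => U j l ω) ^ s)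
      = ∑' j, ENNReal.ofReal ((1 - (k : ℝ) / n) ^ s) ^ j *
        {p : ℝ × (Fin n → ℝ) | p.1 ≤ a}.indicator (terminalValue k s a)
          (excessChain x (fun i => ξ i ω) (fun j l => U j l ω) j) := by
  classical
  filter_upwards [h.ae_unif_mem, h.ae_init_mem, ae_all_iff.2 (ae_level_ne hk hkn hx h hξ hU),
    ae_exists_level_ge hk hkn hx h hξ hU] with ω hu hX hne hex
  set X₀ : Fin n → ℝ := fun i => ξ i ω with hX₀
  set u : ℕ → Fin k → ℝ := fun j l => U j l ω with hu'
  have hmono : Monotone fun j => (excessChain x X₀ u j).1 := excessChain_fst_mono hk hkn hX hu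
  have hlevel : ∀ j, level (expMeasure 1) x X₀ u j = (excessChain x X₀ u j).1 :=
    level_eq_excessChain hk hkn hx.1 hX hu
  have hparticles : ∀ j, particles (expMeasure 1) X₀ u j
      = fun i => (excessChain x X₀ u j).1 + (excessChain x X₀ u j).2 i :=
    particles_eq_excessChain hk hkn hx.1 hX hu
  have hit : iterations (expMeasure 1) a x X₀ u
      = sInf {j : ℕ | a ≤ (excessChain x X₀ u (j + 1)).1} := by
    simp only [iterations, hlevel]
  have hρ : 0 ≤ 1 - (k : ℝ) / n := by
    rw [sub_nonneg]
    exact div_le_one_of_le₀ (by exact_mod_cast hkn) (by positivity)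
  refine ⟨by simpa only [hlevel] using hex, ?_, ?_, fun s => ?_⟩
  · rw [hit]
    exact hitting_add_one_eq_tsum (z := fun j => (excessChain x X₀ u j).1) hmono hx.2 hne hex
  · unfold estimator corrector
    positivity
  · have hcross := crossing_iff_eq_hitting (z := fun j => (excessChain x X₀ u j).1)
      hmono hx.2 hne hex
    simp only [← hit] at hcross
    set N := iterations (expMeasure 1) a x X₀ u with hN
    rw [tsum_eq_single N]
    · obtain ⟨h1, h2⟩ := (hcross N).2 rfl
      rw [indicator_of_mem (show excessChain x X₀ u N ∈ {p : ℝ × (Fin n → ℝ) | p.1 ≤ a} from h1),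
        terminalValue, if_pos (show a ≤ (excessChain x X₀ u N).1
          + orderStat (excessChain x X₀ u N).2 k from h2),
        ← ENNReal.ofReal_pow (by positivity), ← ENNReal.ofReal_mul (by positivity)]
      congr 1
      rw [estimator, corrector, ← hN, hparticles,
        Set.ncard_eq_toFinset_card', mul_pow, mul_comm, ← pow_mul, ← pow_mul, mul_comm N s]
      congr 2
      rw [one_div, inv_mul_eq_div]
      congr 3
      ext i; simp
    · intro j hj
      have : ¬ ((excessChain x X₀ u j).1 ≤ a ∧ a ≤ (excessChain x X₀ u (j + 1)).1) :=
        fun h' => hj ((hcross j).1 h')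
      rw [not_and] at this
      by_cases h1 : (excessChain x X₀ u j).1 ≤ a
      · have h2 : terminalValue k s a (excessChain x X₀ u j) = 0 := if_neg (this h1)
        rw [indicator_apply, h2, ite_self, mul_zero]
      · rw [indicator_of_notMem (by simpa using h1), mul_zero]

omit [IsProbabilityMeasure P] hx h in
lemma measurable_indicator_terminalValue (s : ℕ) (j : ℕ) : Measurable fun ω =>
    {p : ℝ × (Fin n → ℝ) | p.1 ≤ a}.indicator (terminalValue k s a)
      (excessChain x (fun i => ξ i ω) (fun j l => U j l ω) j) :=
  ((measurable_terminalValue hk hkn s a).indicator (measurable_fst measurableSet_Iic)).comp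
    (measurable_excessChain hξ hU j)

lemma lintegral_tsum_terminalValue (s : ℕ) (ρ : ℝ≥0∞) :
    ∫⁻ ω, ∑' j, ρ ^ j * {p : ℝ × (Fin n → ℝ) | p.1 ≤ a}.indicator (terminalValue k s a)
          (excessChain x (fun i => ξ i ω) (fun j l => U j l ω) j) ∂P
      = renewalSum n k ρ (cutoff a (tailMoment n k s)) x := by
  have hm := measurable_indicator_terminalValue (x := x) (a := a) hk hkn hξ hU s
  have hG : Measurable ({p : ℝ × (Fin n → ℝ) | p.1 ≤ a}.indicator (terminalValue k s a)) :=
    (measurable_terminalValue hk hkn s a).indicator (measurable_fst measurableSet_Iic)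
  rw [lintegral_tsum fun j => ((hm j).const_mul _).aemeasurable, renewalSum]
  refine tsum_congr fun j => ?_
  rw [lintegral_const_mul _ (hm j), lintegral_excessChain hk hkn hx h hξ hU j hG,
    ← lintegral_levelLaw x j (measurable_cutoff a _)]
  congr 1
  refine lintegral_congr fun y => ?_
  by_cases hy : y ≤ a
  · rw [cutoff, if_pos hy, ← lintegral_terminalValue hk hkn s hy]
    refine lintegral_congr fun e => ?_
    rw [indicator_of_mem]
    exact hy
  · rw [cutoff, if_neg hy]
    refine (lintegral_congr fun e => ?_).trans lintegral_zero
    rw [indicator_of_notMem]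
    exact hy

lemma expectations_of_measurable :
    (∀ᵐ ω ∂P, ∃ j,
      a ≤ level (expMeasure 1) x (fun i => ξ i ω) (fun j l => U j l ω) (j + 1)) ∧
    (Integrable (fun ω =>
        (iterations (expMeasure 1) a x (fun i => ξ i ω) (fun j l => U j l ω) : ℝ)) P ∧
      (∫ ω, (iterations (expMeasure 1) a x (fun i => ξ i ω) (fun j l => U j l ω) : ℝ) ∂P) + 1
        = (renewalSum n k 1 (cutoff a 1) x).toReal) ∧
    ∀ s : ℕ, Integrable (fun ω =>
        estimator (expMeasure 1) a x (fun i => ξ i ω) (fun j l => U j l ω) ^ s) P ∧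
      ∫ ω, estimator (expMeasure 1) a x (fun i => ξ i ω) (fun j l => U j l ω) ^ s ∂P
        = (renewalSum n k (ENNReal.ofReal ((1 - (k : ℝ) / n) ^ s))
            (cutoff a (tailMoment n k s)) x).toReal := by
  have hae := ae_eq_tsum hk hkn hx h hξ hU
  refine ⟨hae.mono fun ω h => h.1, ?_, fun s => ?_⟩
  · set S : Ω → ℝ≥0∞ := fun ω => ∑' j, (Iic a).indicator (fun _ => (1 : ℝ≥0∞))
        (excessChain x (fun i => ξ i ω) (fun j l => U j l ω) j).1 with hS
    have hSm : Measurable S := Measurable.tsum fun j =>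
      (measurable_const.indicator measurableSet_Iic).comp
        (measurable_fst.comp (measurable_excessChain hξ hU j))
    have hSi : ∫⁻ ω, S ω ∂P = renewalSum n k 1 (cutoff a 1) x :=
      lintegral_tsum_indicator hk hkn hx h hξ hU
    have hfin : ∫⁻ ω, S ω ∂P ≠ ∞ := by
      rw [hSi]; exact (renewalSum_lt_top hk hkn le_rfl (by simp) x).ne
    have heq : (fun ω =>
        (iterations (expMeasure 1) a x (fun i => ξ i ω) (fun j l => U j l ω) : ℝ))
        =ᵐ[P] fun ω => (S ω).toReal - 1 := by
      filter_upwards [hae] with ω hω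
      simp only [hS]
      rw [← hω.2.1, ENNReal.toReal_add (by simp) (by simp)]
      simp
    have hint := integrable_toReal_of_lintegral_ne_top hSm.aemeasurable hfin
    refine ⟨(hint.sub (integrable_const 1)).congr heq.symm, ?_⟩
    rw [integral_congr_ae heq, integral_sub hint (integrable_const 1),
      integral_toReal hSm.aemeasurable (ae_lt_top hSm hfin), hSi]
    simp
  · set ρ := ENNReal.ofReal ((1 - (k : ℝ) / n) ^ s) with hρ
    set S : Ω → ℝ≥0∞ := fun ω => ∑' j, ρ ^ j *
        {p : ℝ × (Fin n → ℝ) | p.1 ≤ a}.indicator (terminalValue k s a)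
          (excessChain x (fun i => ξ i ω) (fun j l => U j l ω) j) with hS
    have hSm : Measurable S := Measurable.tsum fun j =>
      (measurable_indicator_terminalValue (x := x) (a := a) hk hkn hξ hU s j).const_mul _
    have hSi : ∫⁻ ω, S ω ∂P = renewalSum n k ρ (cutoff a (tailMoment n k s)) x :=
      lintegral_tsum_terminalValue hk hkn hx h hξ hU s ρ
    have hkn' : 0 ≤ 1 - (k : ℝ) / n := by
      rw [sub_nonneg]
      exact div_le_one_of_le₀ (by exact_mod_cast hkn) (by positivity)
    have hρ1 : ρ ≤ 1 := by
      rw [hρ, ← ENNReal.ofReal_one]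
      refine ENNReal.ofReal_le_ofReal (pow_le_one₀ hkn' ?_)
      have : 0 ≤ (k : ℝ) / n := by positivity
      linarith
    have hfin : ∫⁻ ω, S ω ∂P ≠ ∞ := by
      rw [hSi]
      exact (renewalSum_lt_top hk hkn hρ1 (fun q hq => tailMoment_le_one n k s hq) x).ne
    have heq : (fun ω =>
        estimator (expMeasure 1) a x (fun i => ξ i ω) (fun j l => U j l ω) ^ s)
        =ᵐ[P] fun ω => (S ω).toReal := by
      filter_upwards [hae] with ω hω
      simp only [hS]
      rw [hρ, ← hω.2.2.2 s, ENNReal.toReal_ofReal (pow_nonneg hω.2.2.1 s)]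
    refine ⟨(integrable_toReal_of_lintegral_ne_top hSm.aemeasurable hfin).congr heq.symm, ?_⟩
    rw [integral_congr_ae heq, integral_toReal hSm.aemeasurable (ae_lt_top hSm hfin), hSi]

end Measurable

/-- `HasLaw` provides only a.e. measurability; the inputs form a countable family, so they can be
replaced by measurable versions off a single null set. -/
theorem IsInput.expectations (hk : 1 ≤ k) (hkn : k ≤ n) (hx : x ∈ Icc 0 a)
    (h : IsInput P (expMeasure 1) x ξ U) :
    (∀ᵐ ω ∂P, ∃ j,
      a ≤ level (expMeasure 1) x (fun i => ξ i ω) (fun j l => U j l ω) (j + 1)) ∧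
    (Integrable (fun ω =>
        (iterations (expMeasure 1) a x (fun i => ξ i ω) (fun j l => U j l ω) : ℝ)) P ∧
      (∫ ω, (iterations (expMeasure 1) a x (fun i => ξ i ω) (fun j l => U j l ω) : ℝ) ∂P) + 1
        = (renewalSum n k 1 (cutoff a 1) x).toReal) ∧
    ∀ s : ℕ, Integrable (fun ω =>
        estimator (expMeasure 1) a x (fun i => ξ i ω) (fun j l => U j l ω) ^ s) P ∧
      ∫ ω, estimator (expMeasure 1) a x (fun i => ξ i ω) (fun j l => U j l ω) ^ s ∂P
        = (renewalSum n k (ENNReal.ofReal ((1 - (k : ℝ) / n) ^ s))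
            (cutoff a (tailMoment n k s)) x).toReal := by
  set ξ' : Fin n → Ω → ℝ := fun i => (h.law_init i).aemeasurable.mk (ξ i) with hξ'
  set U' : ℕ → Fin k → Ω → ℝ := fun j l => (h.law_unif j l).aemeasurable.mk (U j l) with hU'
  have eξ : ∀ i, ξ i =ᵐ[P] ξ' i := fun i => (h.law_init i).aemeasurable.ae_eq_mk
  have eU : ∀ j l, U j l =ᵐ[P] U' j l := fun j l => (h.law_unif j l).aemeasurable.ae_eq_mk
  have h' : IsInput P (expMeasure 1) x ξ' U' := by
    refine ⟨fun i => (h.law_init i).congr (eξ i).symm, fun j l =>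
      (h.law_unif j l).congr (eU j l).symm, h.indep.congr ?_⟩
    rintro (i | q)
    · exact eξ i
    · exact eU q.1 q.2
  have main := expectations_of_measurable hk hkn hx h'
    (fun i => (h.law_init i).aemeasurable.measurable_mk)
    (fun j l => (h.law_unif j l).aemeasurable.measurable_mk)
  have hall : ∀ᵐ ω ∂P, (fun i => ξ i ω) = (fun i => ξ' i ω) ∧
      (fun j l => U j l ω) = fun j l => U' j l ω := by
    have h1 : ∀ᵐ ω ∂P, ∀ i, ξ i ω = ξ' i ω := ae_all_iff.2 eξ
    have h2 : ∀ᵐ ω ∂P, ∀ j l, U j l ω = U' j l ω :=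
      ae_all_iff.2 fun j => ae_all_iff.2 fun l => eU j l
    filter_upwards [h1, h2] with ω h1 h2
    exact ⟨funext h1, funext fun j => funext fun l => h2 j l⟩
  have cJ : (fun ω =>
      (iterations (expMeasure 1) a x (fun i => ξ i ω) (fun j l => U j l ω) : ℝ)) =ᵐ[P]
      fun ω => (iterations (expMeasure 1) a x (fun i => ξ' i ω) (fun j l => U' j l ω) : ℝ) := by
    filter_upwards [hall] with ω hω
    rw [hω.1, hω.2]
  have cp : ∀ s : ℕ, (fun ω =>
      estimator (expMeasure 1) a x (fun i => ξ i ω) (fun j l => U j l ω) ^ s) =ᵐ[P]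
      fun ω => estimator (expMeasure 1) a x (fun i => ξ' i ω) (fun j l => U' j l ω) ^ s := by
    intro s
    filter_upwards [hall] with ω hω
    rw [hω.1, hω.2]
  refine ⟨?_, ⟨main.2.1.1.congr cJ.symm, ?_⟩, fun s => ⟨(main.2.2 s).1.congr (cp s).symm, ?_⟩⟩
  · filter_upwards [hall, main.1] with ω hω hm
    rw [hω.1, hω.2]; exact hm
  · rw [integral_congr_ae cJ]; exact main.2.1.2
  · rw [integral_congr_ae (cp s)]; exact (main.2.2 s).2

end Expectation

/-! ### The Volterra integral equation. -/

/-- The polynomial `Q` such that `Q(e^{-t})` is the density at `t` of `stepLaw n k`. -/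
noncomputable def stepPoly (n k : ℕ) : ℝ[X] :=
  Polynomial.C ((k * n.choose k : ℕ) : ℝ) * Polynomial.X ^ (n - k + 1) * (1 - Polynomial.X) ^ (k - 1)

lemma stepPoly_nonneg (n k : ℕ) {q : ℝ} (hq : q ∈ Icc (0 : ℝ) 1) : 0 ≤ (stepPoly n k).eval q := by
  have h1 := hq.1
  have h2 : 0 ≤ 1 - q := by linarith [hq.2]
  simp only [stepPoly, Polynomial.eval_mul, Polynomial.eval_C, Polynomial.eval_pow,
    Polynomial.eval_X, Polynomial.eval_sub, Polynomial.eval_one]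
  positivity

lemma lintegral_stepLaw (n k : ℕ) {g : ℝ → ℝ≥0∞} (hg : Measurable g) :
    ∫⁻ t, g t ∂stepLaw n k
      = ∫⁻ t in Ici 0, ENNReal.ofReal ((stepPoly n k).eval (Real.exp (-t))) * g t := by
  have he : expMeasure 1 = volume.withDensity (exponentialPDF 1) := rfl
  have hm : Measurable (exponentialPDF 1) := (measurable_exponentialPDFReal 1).ennreal_ofReal
  rw [stepLaw, lintegral_withDensity_eq_lintegral_mul _ (measurable_stepDensity n k) hg, he,
    lintegral_withDensity_eq_lintegral_mul _ hm ((measurable_stepDensity n k).mul hg),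
    ← lintegral_indicator measurableSet_Ici]
  refine lintegral_congr fun t => ?_
  simp only [Pi.mul_apply]
  by_cases ht : 0 ≤ t
  · rw [indicator_of_mem (mem_Ici.2 ht), exponentialPDF_of_nonneg ht, ← mul_assoc, stepDensity]
    congr 1
    have h1 : 0 ≤ 1 - Real.exp (-t) := by simpa using ht
    have h2 := (Real.exp_pos (-t)).le
    rw [← ENNReal.ofReal_natCast, ← ENNReal.ofReal_pow h1, ← ENNReal.ofReal_pow h2,
      ← ENNReal.ofReal_mul (by positivity), ← ENNReal.ofReal_mul (by positivity),
      ← ENNReal.ofReal_mul (by positivity)]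
    congr 1
    simp [stepPoly]
    ring
  · rw [indicator_of_notMem (by simpa using ht), exponentialPDF_of_neg (not_le.1 ht), zero_mul]

/-- Substitute `y = x + t`; the integral stops at `a` because the series vanishes beyond it. -/
lemma renewalOp_renewalSum_eq (n k : ℕ) {a : ℝ} {ρ : ℝ≥0∞} (Q : ℝ[X]) (x : ℝ) :
    renewalOp n k (renewalSum n k ρ (cutoff a Q)) x
      = ∫⁻ y in Icc x a, ENNReal.ofReal ((stepPoly n k).eval (Real.exp (x - y)))
          * renewalSum n k ρ (cutoff a Q) y := by
  have hW := measurable_renewalSum n k ρ (measurable_cutoff a Q)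
  have hWx : Measurable fun t => renewalSum n k ρ (cutoff a Q) (x + t) :=
    hW.comp (measurable_const_add x)
  rw [renewalOp, lintegral_stepLaw n k hWx,
    ← lintegral_indicator measurableSet_Ici, ← lintegral_indicator measurableSet_Icc,
    ← lintegral_add_left_eq_self ((Icc x a).indicator _) x]
  refine lintegral_congr fun t => ?_
  by_cases ht : 0 ≤ t
  · rw [indicator_of_mem (mem_Ici.2 ht)]
    by_cases hta : x + t ≤ a
    · rw [indicator_of_mem (show x + t ∈ Icc x a from ⟨by linarith, hta⟩)]
      congr 4
      ring
    · rw [indicator_of_notMem (fun h => hta h.2), renewalSum_eq_zero _ (not_le.1 hta), mul_zero]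
      intro y hy
      rw [cutoff, if_neg (not_le.2 hy)]
  · rw [indicator_of_notMem (by simpa using ht), indicator_of_notMem]
    intro h
    exact ht (by linarith [h.1])

lemma renewalSum_toReal_eq {n k : ℕ} (hk : 1 ≤ k) (hkn : k ≤ n) {a r : ℝ} (hr : r ∈ Icc (0 : ℝ) 1)
    {Q : ℝ[X]} (hQ0 : ∀ q ∈ Icc (0 : ℝ) 1, 0 ≤ Q.eval q) (hQ1 : ∀ q ∈ Icc (0 : ℝ) 1, Q.eval q ≤ 1)
    {x : ℝ} (hx : x ≤ a) :
    (renewalSum n k (ENNReal.ofReal r) (cutoff a Q) x).toReal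
      = r * (∫ y in x..a, (stepPoly n k).eval (Real.exp (x - y))
          * (renewalSum n k (ENNReal.ofReal r) (cutoff a Q) y).toReal)
        + Q.eval (Real.exp (x - a)) := by
  set ρ := ENNReal.ofReal r with hρ
  have hρ1 : ρ ≤ 1 := by
    rw [hρ, ← ENNReal.ofReal_one]; exact ENNReal.ofReal_le_ofReal hr.2
  have hfin := fun y => renewalSum_lt_top (ρ := ρ) hk hkn hρ1 hQ1 (a := a) y
  have hW := measurable_renewalSum n k ρ (measurable_cutoff a Q)
  have heq := renewalSum_eq n k ρ (measurable_cutoff a Q) x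
  have hne : cutoff a Q x + ρ * renewalOp n k (renewalSum n k ρ (cutoff a Q)) x ≠ ∞ := by
    rw [← heq]; exact (hfin x).ne
  obtain ⟨h1, h2⟩ := ENNReal.add_ne_top.1 hne
  have hexp : Real.exp (x - a) ∈ Icc (0 : ℝ) 1 :=
    ⟨(Real.exp_pos _).le, by rw [Real.exp_le_one_iff]; linarith⟩
  rw [heq, ENNReal.toReal_add h1 h2, add_comm, ENNReal.toReal_mul, cutoff, if_pos hx,
    ENNReal.toReal_ofReal (hQ0 _ hexp), ENNReal.toReal_ofReal hr.1]
  congr 2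
  rw [renewalOp_renewalSum_eq, intervalIntegral.integral_of_le hx,
    ← integral_Icc_eq_integral_Ioc, ← integral_toReal]
  · refine setIntegral_congr_fun measurableSet_Icc fun y hy => ?_
    rw [ENNReal.toReal_mul, ENNReal.toReal_ofReal]
    exact stepPoly_nonneg n k ⟨(Real.exp_pos _).le, by
      rw [Real.exp_le_one_iff]; linarith [hy.1]⟩
  · have h3 : Continuous fun y => (stepPoly n k).eval (Real.exp (x - y)) :=
      (stepPoly n k).continuous.comp (by fun_prop)
    exact (h3.measurable.ennreal_ofReal.mul hW).aemeasurable
  · exact Filter.Eventually.of_forall fun y => ENNReal.mul_lt_top ENNReal.ofReal_lt_top (hfin y)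

lemma integrableOn_renewalSum_toReal {n k : ℕ} (hk : 1 ≤ k) (hkn : k ≤ n) (a : ℝ) {ρ : ℝ≥0∞}
    (hρ : ρ ≤ 1) {Q : ℝ[X]} (hQ1 : ∀ q ∈ Icc (0 : ℝ) 1, Q.eval q ≤ 1) :
    IntegrableOn (fun y => (renewalSum n k ρ (cutoff a Q) y).toReal) (Icc 0 a) := by
  have hW := measurable_renewalSum n k ρ (measurable_cutoff a Q)
  have hc : (1 - stepLaplace n k)⁻¹ < ∞ := by
    rw [ENNReal.inv_lt_top, tsub_pos_iff_lt]; exact stepLaplace_lt_one hk hkn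
  refine Measure.integrableOn_of_bounded (by simp) hW.ennreal_toReal.aestronglyMeasurable
    (M := (1 - stepLaplace n k)⁻¹.toReal * Real.exp a) ?_
  refine (ae_restrict_iff' measurableSet_Icc).2 (Filter.Eventually.of_forall fun y hy => ?_)
  rw [Real.norm_of_nonneg ENNReal.toReal_nonneg]
  have h1 := renewalSum_le (n := n) (k := k) hρ (cutoff_le (a := a) hQ1) y
  have h2 : (1 - stepLaplace n k)⁻¹ * ENNReal.ofReal (Real.exp (a - y)) < ∞ :=
    ENNReal.mul_lt_top hc ENNReal.ofReal_lt_top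
  refine (ENNReal.toReal_mono h2.ne h1).trans ?_
  rw [ENNReal.toReal_mul, ENNReal.toReal_ofReal (Real.exp_pos _).le]
  refine mul_le_mul_of_nonneg_left (Real.exp_le_exp.2 (by linarith [hy.1])) ENNReal.toReal_nonneg

/-! ### Polynomial algebra: the Euler operator and the coefficients `μ`, `r`. -/

section Euler

/-- The operator `X d/dX`, which corresponds to `d/dx` under the substitution `X = e^x`. -/
noncomputable def euler (A : ℝ[X]) : ℝ[X] := Polynomial.X * Polynomial.derivative A

lemma coeff_iterate_euler (A : ℝ[X]) (m i : ℕ) :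
    (euler^[m] A).coeff i = (i : ℝ) ^ m * A.coeff i := by
  induction m with
  | zero => simp
  | succ m ih =>
    have h : ∀ B : ℝ[X], (euler B).coeff i = i * B.coeff i := by
      intro B
      cases i with
      | zero => simp [euler]
      | succ i => rw [euler, Polynomial.coeff_X_mul, Polynomial.coeff_derivative]; push_cast; ring
    rw [Function.iterate_succ_apply', h, ih]
    ring

lemma iterate_euler_add (A B : ℝ[X]) (m : ℕ) :
    euler^[m] (A + B) = euler^[m] A + euler^[m] B := by
  ext i; simp only [coeff_iterate_euler, Polynomial.coeff_add]; ring

lemma iterate_euler_C_mul (c : ℝ) (A : ℝ[X]) (m : ℕ) :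
    euler^[m] (Polynomial.C c * A) = Polynomial.C c * euler^[m] A := by
  ext i; simp only [coeff_iterate_euler, Polynomial.coeff_C_mul]; ring

lemma iterate_euler_X_pow (j m : ℕ) :
    euler^[m] (Polynomial.X ^ j : ℝ[X]) = Polynomial.C ((j : ℝ) ^ m) * Polynomial.X ^ j := by
  ext i
  simp only [coeff_iterate_euler, Polynomial.coeff_C_mul, Polynomial.coeff_X_pow]
  split_ifs with h
  · rw [h]
  · simp

/-- Each application of `euler` lowers the order of vanishing at `1` by at most one, at the cost of
the factor `-(j + 1)`. -/
lemma euler_one_sub_X_pow_mul (j : ℕ) (S : ℝ[X]) :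
    euler ((1 - Polynomial.X) ^ (j + 1) * S) = (1 - Polynomial.X) ^ j *
      (Polynomial.C (-((j : ℝ) + 1)) * Polynomial.X * S
        + (1 - Polynomial.X) * (Polynomial.X * Polynomial.derivative S)) := by
  rw [euler, Polynomial.derivative_mul, Polynomial.derivative_pow]
  simp only [Polynomial.derivative_sub, Polynomial.derivative_one, Polynomial.derivative_X,
    Nat.add_sub_cancel, Polynomial.C_neg, Polynomial.C_add, Polynomial.C_1, Nat.cast_add,
    Nat.cast_one, Polynomial.C_eq_natCast]
  ring

lemma eval_one_iterate_euler (m : ℕ) (S : ℝ[X]) :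
    (euler^[m] ((1 - Polynomial.X) ^ m * S)).eval 1 = (-1) ^ m * m.factorial * S.eval 1 := by
  induction m generalizing S with
  | zero => simp
  | succ m ih =>
    rw [Function.iterate_succ_apply, euler_one_sub_X_pow_mul, ih]
    simp [Nat.factorial_succ]
    ring

lemma eval_one_iterate_euler_eq_zero {m j : ℕ} (h : m < j) (S : ℝ[X]) :
    (euler^[m] ((1 - Polynomial.X) ^ j * S)).eval 1 = 0 := by
  obtain ⟨i, rfl⟩ : ∃ i, j = m + (i + 1) := ⟨j - m - 1, by omega⟩
  rw [pow_add, mul_assoc, eval_one_iterate_euler]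
  simp

/-- The recursion for `r` is multiplication of the characteristic polynomial by `t - (n - k + l +
1)`, read coefficient by coefficient. -/
lemma pow_sub_sum_rRec (n k l : ℕ) (t : ℝ) :
    t ^ l - ∑ m ∈ Finset.range l, rRec n k l m * t ^ m
      = ∏ i ∈ Finset.range l, (t - ((n : ℝ) - k + i + 1)) := by
  induction l with
  | zero => simp
  | succ l ih =>
    rw [Finset.prod_range_succ, ← ih]
    cases l with
    -- Here the constant term comes from the leading monomial rather than from the sum, which
    -- explains the separate sign of `r_{0,1}`.
    | zero => simp [rRec]
    | succ l =>
      set c : ℝ := (n : ℝ) - k + (l + 1 : ℕ) + 1 with hc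
      have h0 : rRec n k (l + 1 + 1) 0 = -c * rRec n k (l + 1) 0 := by
        rw [rRec, if_neg (by omega)]
      have h1 : ∀ m ∈ Finset.range l, rRec n k (l + 1 + 1) (m + 1)
          = rRec n k (l + 1) m - c * rRec n k (l + 1) (m + 1) := by
        intro m hm
        have := Finset.mem_range.1 hm
        rw [rRec, if_pos (by omega)]
      have h2 : rRec n k (l + 1 + 1) (l + 1) = rRec n k (l + 1) l + c := by
        rw [rRec, if_neg (by omega), if_pos rfl]
      have e1 : ∑ m ∈ Finset.range (l + 1 + 1), rRec n k (l + 1 + 1) m * t ^ m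
          = (∑ m ∈ Finset.range l, rRec n k (l + 1) m * t ^ (m + 1))
            - c * (∑ m ∈ Finset.range l, rRec n k (l + 1) (m + 1) * t ^ (m + 1))
            + (rRec n k (l + 1) l + c) * t ^ (l + 1) - c * rRec n k (l + 1) 0 := by
        rw [Finset.sum_range_succ', Finset.sum_range_succ, h0, h2, Finset.mul_sum,
          ← Finset.sum_sub_distrib, Finset.sum_congr rfl fun m hm => by rw [h1 m hm, sub_mul,
            mul_assoc]]
        ring
      have e2 : ∑ m ∈ Finset.range (l + 1), rRec n k (l + 1) m * t ^ m
          = (∑ m ∈ Finset.range l, rRec n k (l + 1) (m + 1) * t ^ (m + 1))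
            + rRec n k (l + 1) 0 := by
        rw [Finset.sum_range_succ']; simp
      have e3 : t * ∑ m ∈ Finset.range (l + 1), rRec n k (l + 1) m * t ^ m
          = (∑ m ∈ Finset.range l, rRec n k (l + 1) m * t ^ (m + 1))
            + rRec n k (l + 1) l * t ^ (l + 1) := by
        rw [Finset.sum_range_succ, mul_add, Finset.mul_sum]
        congr 1
        · exact Finset.sum_congr rfl fun m _ => by ring
        · ring
      rw [e1]
      have e4 : (t ^ (l + 1) - ∑ m ∈ Finset.range (l + 1), rRec n k (l + 1) m * t ^ m) * (t - c)
          = t ^ (l + 1 + 1) - t * (∑ m ∈ Finset.range (l + 1), rRec n k (l + 1) m * t ^ m)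
            - c * t ^ (l + 1)
            + c * ∑ m ∈ Finset.range (l + 1), rRec n k (l + 1) m * t ^ m := by ring
      rw [e4, e3, e2]
      ring

lemma muRec_eq (n k l : ℕ) :
    muRec n k l = ∏ i ∈ Finset.range l, (0 - ((n : ℝ) - k + i + 1)) := by
  induction l with
  | zero => simp [muRec]
  | succ l ih => rw [muRec, Finset.prod_range_succ, ← ih]; ring

lemma r_zero_eq {n k : ℕ} (hk : 1 ≤ k) : r n k 0 = -mu n k := by
  have h := pow_sub_sum_rRec n k k 0
  rw [← muRec_eq, Finset.sum_eq_single 0 (fun m _ hm => by simp [hm])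
    (fun h => absurd (Finset.mem_range.2 hk) h), zero_pow (by omega)] at h
  rw [r, mu, ← h]; simp

lemma muRec_eq_ascFactorial {n k : ℕ} (hkn : k ≤ n) (l : ℕ) :
    muRec n k l = (-1) ^ l * ((n - k + 1).ascFactorial l : ℝ) := by
  induction l with
  | zero => simp [muRec]
  | succ l ih =>
    rw [muRec, ih, Nat.ascFactorial_succ]
    push_cast [Nat.cast_sub hkn]
    ring

/-- Both sides equal `(-1)^(k-1) n!/(n-k)!`. -/
lemma eval_one_iterate_euler_stepPoly {n k : ℕ} (hk : 1 ≤ k) (hkn : k ≤ n) :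
    (euler^[k - 1] (stepPoly n k)).eval 1 = -mu n k := by
  obtain ⟨j, rfl⟩ : ∃ j, k = j + 1 := ⟨k - 1, by omega⟩
  rw [stepPoly, mul_comm, Nat.add_sub_cancel, eval_one_iterate_euler, mu,
    muRec_eq_ascFactorial hkn, Nat.ascFactorial_eq_factorial_mul_choose']
  have : n - (j + 1) + 1 + (j + 1) - 1 = n := by omega
  rw [this]
  simp [Nat.factorial_succ]
  ring

lemma eval_one_iterate_euler_stepPoly_eq_zero {n k m : ℕ} (h : m < k - 1) :
    (euler^[m] (stepPoly n k)).eval 1 = 0 := by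
  rw [stepPoly, mul_comm, eval_one_iterate_euler_eq_zero h]

/-- `euler` multiplies `X^i` by `i`, and the characteristic polynomial has precisely the roots
`n-k+1, …, n`. -/
lemma iterate_euler_eq_sum {n k : ℕ} (hkn : k ≤ n) {A : ℝ[X]}
    (hA : ∀ i, A.coeff i ≠ 0 → n - k + 1 ≤ i ∧ i ≤ n) :
    euler^[k] A = ∑ m ∈ Finset.range k, Polynomial.C (r n k m) * euler^[m] A := by
  ext i
  simp only [Polynomial.finsetSum_coeff, Polynomial.coeff_C_mul, coeff_iterate_euler, ← mul_assoc,
    ← Finset.sum_mul]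
  by_cases h : A.coeff i = 0
  · simp [h]
  · congr 1
    obtain ⟨h1, h2⟩ := hA i h
    have h3 := pow_sub_sum_rRec n k k (i : ℝ)
    rw [Finset.prod_eq_zero (i := i - (n - k + 1)) (Finset.mem_range.2 (by omega))] at h3
    · rw [sub_eq_zero] at h3
      exact h3
    · rw [Nat.cast_sub h1]; push_cast [Nat.cast_sub hkn]; ring

lemma coeff_X_pow_mul_one_sub_X_pow_ne_zero {n b i : ℕ} (hb : b ≤ n) {c : ℝ}
    (h : (Polynomial.C c * Polynomial.X ^ b * (1 - Polynomial.X) ^ (n - b) : ℝ[X]).coeff i ≠ 0) :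
    b ≤ i ∧ i ≤ n := by
  constructor
  · by_contra hlt
    rw [mul_assoc, Polynomial.coeff_C_mul, Polynomial.coeff_X_pow_mul', if_neg hlt, mul_zero] at h
    exact h rfl
  · refine (Polynomial.le_natDegree_of_ne_zero h).trans ?_
    have h1 : (1 - Polynomial.X : ℝ[X]).natDegree ≤ 1 := by compute_degree
    have h2 : ((1 - Polynomial.X : ℝ[X]) ^ (n - b)).natDegree ≤ n - b := by
      simpa using Polynomial.natDegree_pow_le_of_le (n - b) h1
    have h3 : (Polynomial.C c * Polynomial.X ^ b : ℝ[X]).natDegree ≤ b :=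
      Polynomial.natDegree_C_mul_X_pow_le c b
    exact (Polynomial.natDegree_mul_le_of_le h3 h2).trans (by omega)

lemma coeff_stepPoly_ne_zero {n k i : ℕ} (hk : 1 ≤ k) (hkn : k ≤ n)
    (h : (stepPoly n k).coeff i ≠ 0) : n - k + 1 ≤ i ∧ i ≤ n := by
  have : k - 1 = n - (n - k + 1) := by omega
  rw [stepPoly, this] at h
  exact coeff_X_pow_mul_one_sub_X_pow_ne_zero (by omega) h

lemma coeff_tailMoment_ne_zero {n k s i : ℕ} (h : (tailMoment n k s).coeff i ≠ 0) :
    n - k + 1 ≤ i ∧ i ≤ n := by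
  rw [tailMoment, Polynomial.finsetSum_coeff] at h
  obtain ⟨b, hb, hne⟩ := Finset.exists_ne_zero_of_sum_ne_zero h
  obtain ⟨h1, h2⟩ := Finset.mem_Icc.1 hb
  obtain ⟨h3, h4⟩ := coeff_X_pow_mul_one_sub_X_pow_ne_zero h2 hne
  exact ⟨h1.trans h3, h4⟩

/-- The missing terms `b ≤ n - k` are divisible by `(1 - X)^k`, hence invisible at `1` to fewer than
`k` derivatives. The truncated moment may thus be replaced by the full binomial moment. -/
lemma eval_one_iterate_euler_tailMoment {n k m : ℕ} (hkn : k ≤ n) (hm : m < k) (s : ℕ) :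
    (euler^[m] (tailMoment n k s)).eval 1
      = (euler^[m] (∑ b ∈ Finset.range (n + 1), Polynomial.C (((b : ℝ) / n) ^ s)
          * bernsteinPolynomial ℝ n b)).eval 1 := by
  have h : ∑ b ∈ Finset.range (n + 1), Polynomial.C (((b : ℝ) / n) ^ s)
          * bernsteinPolynomial ℝ n b
      = tailMoment n k s + (1 - Polynomial.X) ^ k * ∑ b ∈ Finset.range (n - k + 1),
        Polynomial.C (((b : ℝ) / n) ^ s * n.choose b) * Polynomial.X ^ b
          * (1 - Polynomial.X) ^ (n - k - b) := by
    have hsplit : Finset.range (n + 1) = Finset.Icc (n - k + 1) n ∪ Finset.range (n - k + 1) := by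
      ext b; simp only [Finset.mem_range, Finset.mem_union, Finset.mem_Icc]; omega
    have hdis : Disjoint (Finset.Icc (n - k + 1) n) (Finset.range (n - k + 1)) := by
      rw [Finset.disjoint_left]
      intro b hb hb'
      rw [Finset.mem_Icc] at hb; rw [Finset.mem_range] at hb'; omega
    rw [hsplit, Finset.sum_union hdis, tailMoment, Finset.mul_sum]
    refine congrArg₂ (· + ·) ?_ ?_
    · refine Finset.sum_congr rfl fun b _ => ?_
      rw [bernsteinPolynomial]; simp; ring
    · refine Finset.sum_congr rfl fun b hb => ?_
      have : n - b = k + (n - k - b) := by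
        have := Finset.mem_range.1 hb; omega
      rw [bernsteinPolynomial, this, pow_add]; simp; ring
  rw [h, iterate_euler_add, Polynomial.eval_add, eval_one_iterate_euler_eq_zero hm, add_zero]

lemma eval_one_iterate_euler_tailMoment_one {n k m : ℕ} (hkn : k ≤ n) (hm : m < k) :
    (euler^[m] (tailMoment n k 1)).eval 1 = 1 := by
  have hn : (n : ℝ) ≠ 0 := by
    have : n ≠ 0 := by omega
    exact_mod_cast this
  have h : ∑ b ∈ Finset.range (n + 1), Polynomial.C (((b : ℝ) / n) ^ 1)
          * bernsteinPolynomial ℝ n b = Polynomial.C (1 / (n : ℝ)) *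
      ∑ b ∈ Finset.range (n + 1), b • bernsteinPolynomial ℝ n b := by
    rw [Finset.mul_sum]
    refine Finset.sum_congr rfl fun b _ => ?_
    rw [nsmul_eq_mul, ← Polynomial.C_eq_natCast, ← mul_assoc, ← Polynomial.C_mul]
    congr 2; ring
  have hX : n • (Polynomial.X : ℝ[X]) = Polynomial.C (n : ℝ) * Polynomial.X ^ 1 := by
    rw [pow_one, nsmul_eq_mul, Polynomial.C_eq_natCast]
  rw [eval_one_iterate_euler_tailMoment hkn hm, h, bernsteinPolynomial.sum_smul, hX,
    iterate_euler_C_mul, iterate_euler_C_mul, iterate_euler_X_pow]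
  simp [hn]

/-- Writing `b^2 = b + b(b-1)`, the full second moment is `X/n + (1 - 1/n) X^2`. -/
lemma eval_one_iterate_euler_tailMoment_two {n k m : ℕ} (hkn : k ≤ n) (hm : m < k) :
    (euler^[m] (tailMoment n k 2)).eval 1 = 1 / (n : ℝ) + (1 - 1 / (n : ℝ)) * 2 ^ m := by
  have hn0 : 1 ≤ n := by omega
  have hn : (n : ℝ) ≠ 0 := by
    have : n ≠ 0 := by omega
    exact_mod_cast this
  have h : ∑ b ∈ Finset.range (n + 1), Polynomial.C (((b : ℝ) / n) ^ 2)
          * bernsteinPolynomial ℝ n b = Polynomial.C (1 / (n : ℝ) ^ 2) *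
      (∑ b ∈ Finset.range (n + 1), b • bernsteinPolynomial ℝ n b
        + ∑ b ∈ Finset.range (n + 1), (b * (b - 1)) • bernsteinPolynomial ℝ n b) := by
    rw [← Finset.sum_add_distrib, Finset.mul_sum]
    refine Finset.sum_congr rfl fun b _ => ?_
    rw [← add_nsmul, nsmul_eq_mul, ← Polynomial.C_eq_natCast, ← mul_assoc, ← Polynomial.C_mul]
    congr 2
    have : b + b * (b - 1) = b ^ 2 := by
      cases b with
      | zero => rfl
      | succ b => rw [Nat.add_sub_cancel]; ring
    rw [this]; push_cast; ring
  have hX : n • (Polynomial.X : ℝ[X]) = Polynomial.C (n : ℝ) * Polynomial.X ^ 1 := by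
    rw [pow_one, nsmul_eq_mul, Polynomial.C_eq_natCast]
  have hX2 : (n * (n - 1)) • (Polynomial.X : ℝ[X]) ^ 2
      = Polynomial.C ((n * (n - 1) : ℕ) : ℝ) * Polynomial.X ^ 2 := by
    rw [nsmul_eq_mul, Polynomial.C_eq_natCast]
  rw [eval_one_iterate_euler_tailMoment hkn hm, h, bernsteinPolynomial.sum_smul,
    bernsteinPolynomial.sum_mul_smul, hX, hX2, iterate_euler_C_mul, iterate_euler_add,
    iterate_euler_C_mul, iterate_euler_C_mul, iterate_euler_X_pow, iterate_euler_X_pow]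
  simp only [Polynomial.eval_mul, Polynomial.eval_add, Polynomial.eval_C, Polynomial.eval_pow,
    Polynomial.eval_X]
  push_cast [Nat.cast_sub hn0]
  field_simp
  simp

end Euler

/-! ### Differentiating the Volterra equation. -/

lemma iteratedDerivWithin_eq_of_hasDerivWithinAt {s : Set ℝ} (hs : UniqueDiffOn ℝ s) {k : ℕ}
    {G : ℕ → ℝ → ℝ} (hG : ∀ m < k, ∀ x ∈ s, HasDerivWithinAt (G m) (G (m + 1) x) s x)
    {m : ℕ} (hm : m ≤ k) : ∀ x ∈ s, iteratedDerivWithin m (G 0) s x = G m x := by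
  induction m with
  | zero => intro x _; simp
  | succ m ih =>
    intro x hx
    have h1 : EqOn (iteratedDerivWithin m (G 0) s) (G m) s := ih (by omega)
    rw [iteratedDerivWithin_succ, derivWithin_congr h1 (h1 hx)]
    exact (hG m (by omega) x hx).derivWithin (hs x hx)

lemma contDiffOn_of_hasDerivWithinAt {s : Set ℝ} (hs : UniqueDiffOn ℝ s) {k : ℕ}
    {G : ℕ → ℝ → ℝ} (hG : ∀ m < k, ∀ x ∈ s, HasDerivWithinAt (G m) (G (m + 1) x) s x)
    (hGk : ContinuousOn (G k) s) : ContDiffOn ℝ k (G 0) s := by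
  have heq : ∀ m ≤ k, EqOn (iteratedDerivWithin m (G 0) s) (G m) s := fun m hm =>
    iteratedDerivWithin_eq_of_hasDerivWithinAt hs hG hm
  rw [contDiffOn_nat_iff_continuousOn_differentiableOn_deriv hs]
  have hd : ∀ m < k, DifferentiableOn ℝ (iteratedDerivWithin m (G 0) s) s := fun m hm =>
    (show DifferentiableOn ℝ (G m) s from
      fun x hx => (hG m hm x hx).differentiableWithinAt).congr (heq m hm.le)
  refine ⟨fun m hm => ?_, hd⟩
  rcases hm.lt_or_eq with h | h
  · exact (hd m h).continuousOn
  · subst h; exact hGk.congr (heq m le_rfl)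

/-- For a monomial the kernel separates, so `x` leaves the integrand: continuity and derivatives
follow from the fundamental theorem of calculus, without differentiating under the integral sign. -/
lemma integral_monomial_exp (a : ℝ) (w : ℝ → ℝ) (i : ℕ) (c x : ℝ) :
    ∫ y in x..a, (Polynomial.monomial i c).eval (Real.exp (x - y)) * w y
      = c * Real.exp (i * x) * ∫ y in x..a, Real.exp (-(i * y)) * w y := by
  rw [← intervalIntegral.integral_const_mul]
  refine intervalIntegral.integral_congr fun y _ => ?_
  simp only [Polynomial.eval_monomial]
  rw [← Real.exp_nat_mul, mul_sub, sub_eq_add_neg, Real.exp_add]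
  ring

lemma continuous_eval_exp_sub (A : ℝ[X]) (x : ℝ) :
    Continuous fun y => A.eval (Real.exp (x - y)) := A.continuous.comp (by fun_prop)

lemma integral_eval_add {a x : ℝ} {w : ℝ → ℝ} (hw : IntervalIntegrable w volume x a)
    (A B : ℝ[X]) :
    ∫ y in x..a, (A + B).eval (Real.exp (x - y)) * w y
      = (∫ y in x..a, A.eval (Real.exp (x - y)) * w y)
        + ∫ y in x..a, B.eval (Real.exp (x - y)) * w y := by
  rw [← intervalIntegral.integral_add
    (hw.continuousOn_mul (continuous_eval_exp_sub A x).continuousOn)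
    (hw.continuousOn_mul (continuous_eval_exp_sub B x).continuousOn)]
  refine intervalIntegral.integral_congr fun y _ => ?_
  simp only [Polynomial.eval_add, add_mul]

lemma continuousOn_integral_eval {a : ℝ} (ha : 0 ≤ a) {w : ℝ → ℝ}
    (hw : IntegrableOn w (Icc 0 a)) (A : ℝ[X]) :
    ContinuousOn (fun x => ∫ y in x..a, A.eval (Real.exp (x - y)) * w y) (Icc 0 a) := by
  have hint : ∀ x ∈ Icc 0 a, IntervalIntegrable w volume x a := fun x hx =>
    (intervalIntegrable_iff_integrableOn_Icc_of_le hx.2).2 (hw.mono_set (Icc_subset_Icc_left hx.1))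
  induction A using Polynomial.induction_on' with
  | add A B hA hB =>
    exact (hA.add hB).congr fun x hx => integral_eval_add (hint x hx) A B
  | monomial i c =>
    simp only [integral_monomial_exp]
    refine ContinuousOn.mul (by fun_prop) ?_
    rw [← uIcc_of_le ha]
    refine intervalIntegral.continuousOn_primitive_interval_left ?_
    rw [uIcc_of_le ha]
    exact hw.continuousOn_mul (by fun_prop) isCompact_Icc

lemma euler_monomial (i : ℕ) (c : ℝ) :
    euler (Polynomial.monomial i c) = Polynomial.monomial i (c * i) := by
  ext j
  have := coeff_iterate_euler (Polynomial.monomial i c) 1 j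
  simp only [Function.iterate_one, pow_one, Polynomial.coeff_monomial] at this ⊢
  rw [this]
  split_ifs with h
  · rw [h, mul_comm]
  · simp

lemma hasDerivAt_integral_eval (a : ℝ) {w : ℝ → ℝ} (hw : Continuous w) (A : ℝ[X]) (x : ℝ) :
    HasDerivAt (fun x => ∫ y in x..a, A.eval (Real.exp (x - y)) * w y)
      ((∫ y in x..a, (euler A).eval (Real.exp (x - y)) * w y) - A.eval 1 * w x) x := by
  induction A using Polynomial.induction_on' with
  | add A B hA hB =>
    have he : euler (A + B) = euler A + euler B := iterate_euler_add A B 1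
    have h := hA.add hB
    have hf : (fun x => ∫ y in x..a, (A + B).eval (Real.exp (x - y)) * w y)
        = (fun x => ∫ y in x..a, A.eval (Real.exp (x - y)) * w y)
          + fun x => ∫ y in x..a, B.eval (Real.exp (x - y)) * w y :=
      funext fun x => integral_eval_add (hw.intervalIntegrable _ _) A B
    rw [hf, he, integral_eval_add (hw.intervalIntegrable _ _), Polynomial.eval_add]
    refine h.congr_deriv ?_
    ring
  | monomial i c =>
    simp only [euler_monomial, integral_monomial_exp]
    have hc : Continuous fun y => Real.exp (-(i * y)) * w y := by fun_prop
    have h1 : HasDerivAt (fun x => ∫ y in x..a, Real.exp (-(i * y)) * w y)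
        (-(Real.exp (-(i * x)) * w x)) x :=
      intervalIntegral.integral_hasDerivAt_left (hc.intervalIntegrable _ _)
        (hc.stronglyMeasurableAtFilter _ _) hc.continuousAt
    have h2 : HasDerivAt (fun x : ℝ => c * Real.exp (i * x)) (c * (Real.exp (i * x) * i)) x := by
      have := ((hasDerivAt_id x).const_mul (i : ℝ)).exp.const_mul c
      simpa using this
    refine (h2.mul h1).congr_deriv ?_
    have h3 : Real.exp (i * x) * Real.exp (-(i * x)) = 1 := by rw [← Real.exp_add]; simp
    simp only [Polynomial.eval_monomial, one_pow, mul_one]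
    linear_combination (-(c * w x)) * h3

lemma hasDerivAt_eval_exp (a : ℝ) (A : ℝ[X]) (x : ℝ) :
    HasDerivAt (fun x => A.eval (Real.exp (x - a))) ((euler A).eval (Real.exp (x - a))) x := by
  have h1 : HasDerivAt (fun x => Real.exp (x - a)) (Real.exp (x - a)) x := by
    simpa using ((hasDerivAt_id x).sub_const a).exp
  have h2 := (A.hasDerivAt (Real.exp (x - a))).comp x h1
  refine h2.congr_deriv ?_
  simp [euler, mul_comm]

/-- A solution of a renewal equation on `[0, a]` whose kernel and source term are polynomials in
`e^x` is as smooth as the order of vanishing of the kernel on the diagonal allows. -/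
lemma volterra_derivatives {a : ℝ} (ha : 0 < a) {k : ℕ} (hk : 1 ≤ k) {K Q : ℝ[X]} {w : ℝ → ℝ}
    (hw : IntegrableOn w (Icc 0 a))
    (heq : ∀ x ∈ Icc 0 a, w x = (∫ y in x..a, K.eval (Real.exp (x - y)) * w y)
      + Q.eval (Real.exp (x - a)))
    (hK : ∀ m < k - 1, (euler^[m] K).eval 1 = 0) :
    ContDiffOn ℝ k w (Icc 0 a) ∧
    (∀ m < k, ∀ x ∈ Icc 0 a, iteratedDerivWithin m w (Icc 0 a) x
      = (∫ y in x..a, (euler^[m] K).eval (Real.exp (x - y)) * w y)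
        + (euler^[m] Q).eval (Real.exp (x - a))) ∧
    ∀ x ∈ Icc 0 a, iteratedDerivWithin k w (Icc 0 a) x
      = (∫ y in x..a, (euler^[k] K).eval (Real.exp (x - y)) * w y)
        + (euler^[k] Q).eval (Real.exp (x - a)) - (euler^[k - 1] K).eval 1 * w x := by
  -- Bootstrap: integrability of `w` makes the right-hand side of the equation continuous, hence `w`
  -- itself.
  have hcw : ContinuousOn w (Icc 0 a) := by
    have hQ : Continuous fun x => Q.eval (Real.exp (x - a)) := Q.continuous.comp (by fun_prop)
    exact ((continuousOn_integral_eval ha.le hw K).add hQ.continuousOn).congr heq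
  -- A continuous extension to the line allows ordinary derivatives at every point, the endpoints
  -- included.
  set v : ℝ → ℝ := IccExtend ha.le ((Icc 0 a).domRestrict w) with hv
  have hvc : Continuous v := (hcw.domRestrict).Icc_extend'
  have hvw : ∀ x ∈ Icc 0 a, v x = w x := fun x hx => by
    rw [hv, IccExtend_of_mem _ _ hx]; rfl
  have hint : ∀ A : ℝ[X], ∀ x ∈ Icc 0 a, ∫ y in x..a, A.eval (Real.exp (x - y)) * v y
      = ∫ y in x..a, A.eval (Real.exp (x - y)) * w y := by
    intro A x hx
    refine intervalIntegral.integral_congr fun y hy => ?_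
    rw [uIcc_of_le hx.2] at hy
    simp only [hvw y ⟨hx.1.trans hy.1, hy.2⟩]
  set F : ℕ → ℝ → ℝ := fun m x => (∫ y in x..a, (euler^[m] K).eval (Real.exp (x - y)) * v y)
        + (euler^[m] Q).eval (Real.exp (x - a)) with hF
  have hFd : ∀ m x, HasDerivAt (F m) (F (m + 1) x - (euler^[m] K).eval 1 * v x) x := by
    intro m x
    have h := (hasDerivAt_integral_eval a hvc (euler^[m] K) x).add
      (hasDerivAt_eval_exp a (euler^[m] Q) x)
    refine h.congr_deriv ?_
    simp only [hF, Function.iterate_succ_apply']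
    ring
  -- The candidate derivatives: the boundary term produced by differentiating the integral is zero
  -- until order `k - 1` is differentiated, so it enters at `m = k` only.
  set G : ℕ → ℝ → ℝ := fun m x =>
    F m x - if m = k then (euler^[k - 1] K).eval 1 * v x else 0 with hG
  have hGd : ∀ m < k, ∀ x ∈ Icc 0 a, HasDerivWithinAt (G m) (G (m + 1) x) (Icc 0 a) x := by
    intro m hm x _
    have h1 : G m = F m := by ext x; simp [hG, hm.ne]
    rw [h1]
    refine (hFd m x).hasDerivWithinAt.congr_deriv ?_
    simp only [hG]
    split_ifs with h
    · have : k - 1 = m := by omega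
      rw [this]
    · rw [hK m (by omega), zero_mul]
  have hGk : ContinuousOn (G k) (Icc 0 a) := by
    have : Continuous (F k) := continuous_iff_continuousAt.2 fun x => (hFd k x).continuousAt
    simp only [hG, if_true]
    fun_prop
  have hs := uniqueDiffOn_Icc ha
  have hw0 : EqOn w (G 0) (Icc 0 a) := by
    intro x hx
    have : (0 : ℕ) ≠ k := by omega
    simp only [hG, hF, Function.iterate_zero, id_eq, if_neg this, sub_zero]
    rw [heq x hx, hint K x hx]
  refine ⟨(contDiffOn_of_hasDerivWithinAt hs hGd hGk).congr hw0, ?_, ?_⟩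
  · intro m hm x hx
    rw [iteratedDerivWithin_congr hw0 hx,
      iteratedDerivWithin_eq_of_hasDerivWithinAt hs hGd hm.le x hx]
    simp only [hG, hF, if_neg hm.ne, sub_zero]
    rw [hint _ x hx]
  · intro x hx
    rw [iteratedDerivWithin_congr hw0 hx,
      iteratedDerivWithin_eq_of_hasDerivWithinAt hs hGd le_rfl x hx]
    simp only [hG, hF, if_true]
    rw [hint _ x hx, hvw x hx]

lemma integral_sum_eval {a x : ℝ} {w : ℝ → ℝ} (hw : IntervalIntegrable w volume x a)
    {ι : Type*} (s : Finset ι) (c : ι → ℝ) (A : ι → ℝ[X]) :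
    ∫ y in x..a, (∑ i ∈ s, Polynomial.C (c i) * A i).eval (Real.exp (x - y)) * w y
      = ∑ i ∈ s, c i * ∫ y in x..a, (A i).eval (Real.exp (x - y)) * w y := by
  simp only [← intervalIntegral.integral_const_mul]
  rw [← intervalIntegral.integral_finsetSum fun i _ =>
    (hw.continuousOn_mul (continuous_eval_exp_sub (A i) x).continuousOn).const_mul (c i)]
  refine intervalIntegral.integral_congr fun y _ => ?_
  simp only [Polynomial.eval_finsetSum, Polynomial.eval_mul, Polynomial.eval_C, Finset.sum_mul,
    mul_assoc]

/-! ### The differential equations and the boundary values. -/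

/-- The functions given by a renewal equation with step law `stepLaw n k` are of class `C^k`, and
their derivatives satisfy a linear relation, up to the contribution of the source term. -/
lemma renewal_derivatives {n k : ℕ} (hk : 1 ≤ k) (hkn : k ≤ n) {a : ℝ} (ha : 0 < a) {r₀ : ℝ}
    (hr : r₀ ∈ Icc (0 : ℝ) 1) {Q : ℝ[X]} (hQ0 : ∀ q ∈ Icc (0 : ℝ) 1, 0 ≤ Q.eval q)
    (hQ1 : ∀ q ∈ Icc (0 : ℝ) 1, Q.eval q ≤ 1) {f : ℝ → ℝ}
    (hf : ∀ x ∈ Icc 0 a,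
      f x = (renewalSum n k (ENNReal.ofReal r₀) (cutoff a Q) x).toReal) :
    ContDiffOn ℝ k f (Icc 0 a) ∧
    (∀ m < k, iteratedDerivWithin m f (Icc 0 a) a = (euler^[m] Q).eval 1) ∧
    ∀ x ∈ Icc 0 a, iteratedDerivWithin k f (Icc 0 a) x
      = r₀ * mu n k * f x
        + ∑ m ∈ Finset.range k, r n k m * (iteratedDerivWithin m f (Icc 0 a) x
          - (euler^[m] Q).eval (Real.exp (x - a)))
        + (euler^[k] Q).eval (Real.exp (x - a)) := by
  have hρ1 : ENNReal.ofReal r₀ ≤ 1 := by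
    rw [← ENNReal.ofReal_one]; exact ENNReal.ofReal_le_ofReal hr.2
  have hint : IntegrableOn f (Icc 0 a) :=
    (integrableOn_renewalSum_toReal hk hkn a hρ1 hQ1).congr_fun
      (fun x hx => (hf x hx).symm) measurableSet_Icc
  have hii : ∀ x ∈ Icc 0 a, IntervalIntegrable f volume x a := fun x hx =>
    (intervalIntegrable_iff_integrableOn_Icc_of_le hx.2).2
      (hint.mono_set (Icc_subset_Icc_left hx.1))
  set K := Polynomial.C r₀ * stepPoly n k with hKdef
  have heq : ∀ x ∈ Icc 0 a, f x = (∫ y in x..a, K.eval (Real.exp (x - y)) * f y)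
      + Q.eval (Real.exp (x - a)) := by
    intro x hx
    rw [hf x hx, renewalSum_toReal_eq hk hkn hr hQ0 hQ1 hx.2,
      ← intervalIntegral.integral_const_mul]
    congr 1
    refine intervalIntegral.integral_congr fun y hy => ?_
    rw [uIcc_of_le hx.2] at hy
    simp only [hKdef, Polynomial.eval_mul, Polynomial.eval_C,
      hf y ⟨hx.1.trans hy.1, hy.2⟩, mul_assoc]
  obtain ⟨h1, h2, h3⟩ := volterra_derivatives ha hk hint heq fun m hm => by
    rw [hKdef, iterate_euler_C_mul, Polynomial.eval_mul,
      eval_one_iterate_euler_stepPoly_eq_zero hm, mul_zero]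
  refine ⟨h1, fun m hm => ?_, fun x hx => ?_⟩
  · rw [h2 m hm a (right_mem_Icc.2 ha.le)]
    simp
  · have hsum : euler^[k] K = ∑ m ∈ Finset.range k, Polynomial.C (r n k m) * euler^[m] K := by
      refine iterate_euler_eq_sum hkn fun i hi => coeff_stepPoly_ne_zero hk hkn ?_
      rw [hKdef, Polynomial.coeff_C_mul] at hi
      exact right_ne_zero_of_mul hi
    have hmu : (euler^[k - 1] K).eval 1 = -(r₀ * mu n k) := by
      rw [hKdef, iterate_euler_C_mul, Polynomial.eval_mul, Polynomial.eval_C,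
        eval_one_iterate_euler_stepPoly hk hkn]
      ring
    rw [h3 x hx, hsum, integral_sum_eval (hii x hx), hmu]
    -- Below order `k`, each integral is the derivative of `f` minus that of the source; this
    -- eliminates the integrals.
    have h4 : ∀ m ∈ Finset.range k, r n k m * (iteratedDerivWithin m f (Icc 0 a) x
          - (euler^[m] Q).eval (Real.exp (x - a)))
        = r n k m * ∫ y in x..a, (euler^[m] K).eval (Real.exp (x - y)) * f y := by
      intro m hm
      rw [h2 m (Finset.mem_range.1 hm) x hx, add_sub_cancel_right]
    rw [Finset.sum_congr rfl h4]
    ring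

lemma iterate_euler_one (m : ℕ) :
    euler^[m] (1 : ℝ[X]) = Polynomial.C (if m = 0 then 1 else 0) := by
  have h := iterate_euler_X_pow 0 m
  rw [pow_zero, mul_one] at h
  rw [h]
  split_ifs with hm <;> simp [hm]

/-- The exponents of `tailMoment` lie in the same range as those of the kernel, so the source
satisfies the same linear relation and its contributions cancel. -/
lemma renewal_ode_of_tailMoment {n k : ℕ} (hk : 1 ≤ k) (hkn : k ≤ n) {a : ℝ} (ha : 0 < a) (s : ℕ)
    {f : ℝ → ℝ} (hf : ∀ x ∈ Icc 0 a,
      f x = (renewalSum n k (ENNReal.ofReal ((1 - (k : ℝ) / n) ^ s))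
        (cutoff a (tailMoment n k s)) x).toReal) :
    ContDiffOn ℝ k f (Icc 0 a) ∧
    (∀ m < k, iteratedDerivWithin m f (Icc 0 a) a = (euler^[m] (tailMoment n k s)).eval 1) ∧
    ∀ x ∈ Icc 0 a, iteratedDerivWithin k f (Icc 0 a) x
      = (1 - (k : ℝ) / n) ^ s * mu n k * f x
        + ∑ m ∈ Finset.range k, r n k m * iteratedDerivWithin m f (Icc 0 a) x := by
  have hr : (1 - (k : ℝ) / n) ^ s ∈ Icc (0 : ℝ) 1 := by
    have h1 : (k : ℝ) / n ≤ 1 := div_le_one_of_le₀ (by exact_mod_cast hkn) (by positivity)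
    have h2 : 0 ≤ (k : ℝ) / n := by positivity
    exact ⟨pow_nonneg (by linarith) s, pow_le_one₀ (by linarith) (by linarith)⟩
  obtain ⟨h1, h2, h3⟩ := renewal_derivatives hk hkn ha hr
    (fun q hq => tailMoment_nonneg n k s hq) (fun q hq => tailMoment_le_one n k s hq) hf
  refine ⟨h1, h2, fun x hx => ?_⟩
  have h4 : (euler^[k] (tailMoment n k s)).eval (Real.exp (x - a))
      = ∑ m ∈ Finset.range k,
        r n k m * (euler^[m] (tailMoment n k s)).eval (Real.exp (x - a)) := by
    rw [iterate_euler_eq_sum hkn fun i => coeff_tailMoment_ne_zero]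
    simp [Polynomial.eval_finsetSum]
  rw [h3 x hx, h4, add_assoc, ← Finset.sum_add_distrib]
  congr 1
  exact Finset.sum_congr rfl fun m _ => by ring

/-- The source is constant, so it survives only at `m = 0`. Since `r_0 = -μ`, the terms `μ f + r_0
(f - 1)` collapse to the constant `μ`, which also removes the index `0` from the sum. -/
lemma renewal_ode_of_one {n k : ℕ} (hk : 1 ≤ k) (hkn : k ≤ n) {a : ℝ} (ha : 0 < a)
    {f : ℝ → ℝ} (hf : ∀ x ∈ Icc 0 a, f x = (renewalSum n k 1 (cutoff a 1) x).toReal) :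
    ContDiffOn ℝ k f (Icc 0 a) ∧
    (∀ m < k, iteratedDerivWithin m f (Icc 0 a) a = if m = 0 then 1 else 0) ∧
    ∀ x ∈ Icc 0 a, iteratedDerivWithin k f (Icc 0 a) x
      = (∑ m ∈ Finset.Icc 1 (k - 1), r n k m * iteratedDerivWithin m f (Icc 0 a) x) + mu n k := by
  obtain ⟨h1, h2, h3⟩ := renewal_derivatives (r₀ := 1) (Q := 1) hk hkn ha (by simp)
    (by simp) (by simp) (f := f) (by simpa using hf)
  refine ⟨h1, fun m hm => ?_, fun x hx => ?_⟩
  · rw [h2 m hm, iterate_euler_one, Polynomial.eval_C]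
  · have hset : Finset.range k = insert 0 (Finset.Icc 1 (k - 1)) := by
      ext m; simp only [Finset.mem_range, Finset.mem_insert, Finset.mem_Icc]; omega
    have hk0 : k ≠ 0 := by omega
    rw [h3 x hx, hset, Finset.sum_insert (by simp)]
    simp only [iterate_euler_one, Polynomial.eval_C, iteratedDerivWithin_zero, r_zero_eq hk,
      if_neg hk0, if_true]
    have h4 : ∀ m ∈ Finset.Icc 1 (k - 1), r n k m * (iteratedDerivWithin m f (Icc 0 a) x
        - if m = 0 then 1 else 0) = r n k m * iteratedDerivWithin m f (Icc 0 a) x := by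
      intro m hm
      rw [if_neg (by have := (Finset.mem_Icc.1 hm).1; omega), sub_zero]
    rw [Finset.sum_congr rfl h4]
    ring

end AMS

/-- The exponential case: `X` has the exponential law with parameter `1`. For each starting point
`x ∈ [0, a]`, `ξ x` and `U x` are random inputs of the algorithm started at `x`; no relation is
assumed between different starting points. -/
theorem proposition6p3 (n k : ℕ) (hk : 1 ≤ k) (hkn : k + 2 ≤ n) (a : ℝ) (ha : 0 < a)
    {Ω : Type*} [MeasurableSpace Ω] (P : Measure Ω) [IsProbabilityMeasure P]
    (ξ : ℝ → Fin n → Ω → ℝ) (U : ℝ → ℕ → Fin k → Ω → ℝ)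
    (hinput : ∀ x ∈ Icc 0 a, AMS.IsInput P (expMeasure 1) x (ξ x) (U x)) :
    -- the algorithm stops almost surely, and the three expectations are those of
    -- integrable random variables
    (∀ x ∈ Icc 0 a,
      (∀ᵐ ω ∂P, ∃ j : ℕ, a ≤ AMS.level (expMeasure 1) x (fun i => ξ x i ω)
        (fun j l => U x j l ω) (j + 1)) ∧
      Integrable (fun ω => AMS.pHat (expMeasure 1) a ξ U x ω) P ∧
      Integrable (fun ω => AMS.pHat (expMeasure 1) a ξ U x ω ^ 2) P ∧
      Integrable (fun ω => (AMS.J (expMeasure 1) a ξ U x ω : ℝ)) P) ∧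
    -- the three functions are of class `C^k` on `[0, a]`, with one-sided derivatives at `0` and `a`
    ContDiffOn ℝ k (AMS.pFun P (expMeasure 1) a ξ U) (Icc 0 a) ∧
    ContDiffOn ℝ k (AMS.vFun P (expMeasure 1) a ξ U) (Icc 0 a) ∧
    ContDiffOn ℝ k (AMS.TFun P (expMeasure 1) a ξ U) (Icc 0 a) ∧
    -- the linear differential equations of order `k`
    (∀ x ∈ Icc 0 a,
      iteratedDerivWithin k (AMS.pFun P (expMeasure 1) a ξ U) (Icc 0 a) x =
        (1 - (k : ℝ) / n) * AMS.mu n k * AMS.pFun P (expMeasure 1) a ξ U x +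
          ∑ m ∈ Finset.range k, AMS.r n k m *
            iteratedDerivWithin m (AMS.pFun P (expMeasure 1) a ξ U) (Icc 0 a) x) ∧
    (∀ x ∈ Icc 0 a,
      iteratedDerivWithin k (AMS.vFun P (expMeasure 1) a ξ U) (Icc 0 a) x =
        (1 - (k : ℝ) / n) ^ 2 * AMS.mu n k * AMS.vFun P (expMeasure 1) a ξ U x +
          ∑ m ∈ Finset.range k, AMS.r n k m *
            iteratedDerivWithin m (AMS.vFun P (expMeasure 1) a ξ U) (Icc 0 a) x) ∧
    (∀ x ∈ Icc 0 a,
      iteratedDerivWithin k (AMS.TFun P (expMeasure 1) a ξ U) (Icc 0 a) x =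
        (∑ m ∈ Finset.Icc 1 (k - 1), AMS.r n k m *
            iteratedDerivWithin m (AMS.TFun P (expMeasure 1) a ξ U) (Icc 0 a) x) +
          AMS.mu n k) ∧
    -- the boundary conditions at `a`
    (∀ m < k,
      iteratedDerivWithin m (AMS.pFun P (expMeasure 1) a ξ U) (Icc 0 a) a = 1 ∧
      iteratedDerivWithin m (AMS.vFun P (expMeasure 1) a ξ U) (Icc 0 a) a =
        1 / (n : ℝ) + (1 - 1 / (n : ℝ)) * 2 ^ m ∧
      iteratedDerivWithin m (AMS.TFun P (expMeasure 1) a ξ U) (Icc 0 a) a =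
        if m = 0 then 1 else 0) := by
  have hkn' : k ≤ n := by omega
  have hexp := fun x hx => (hinput x hx).expectations hk hkn' hx
  have hp : ∀ x ∈ Icc 0 a, AMS.pFun P (expMeasure 1) a ξ U x
      = (AMS.renewalSum n k (ENNReal.ofReal ((1 - (k : ℝ) / n) ^ 1))
        (AMS.cutoff a (AMS.tailMoment n k 1)) x).toReal := fun x hx => by
    rw [← ((hexp x hx).2.2 1).2]
    simp only [pow_one]
    rfl
  have hv : ∀ x ∈ Icc 0 a, AMS.vFun P (expMeasure 1) a ξ U x
      = (AMS.renewalSum n k (ENNReal.ofReal ((1 - (k : ℝ) / n) ^ 2))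
        (AMS.cutoff a (AMS.tailMoment n k 2)) x).toReal := fun x hx =>
    ((hexp x hx).2.2 2).2
  have hT : ∀ x ∈ Icc 0 a, AMS.TFun P (expMeasure 1) a ξ U x
      = (AMS.renewalSum n k 1 (AMS.cutoff a 1) x).toReal := fun x hx => (hexp x hx).2.1.2
  obtain ⟨p1, p2, p3⟩ := AMS.renewal_ode_of_tailMoment hk hkn' ha 1 hp
  obtain ⟨v1, v2, v3⟩ := AMS.renewal_ode_of_tailMoment hk hkn' ha 2 hv
  obtain ⟨T1, T2, T3⟩ := AMS.renewal_ode_of_one hk hkn' ha hT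
  refine ⟨fun x hx => ⟨(hexp x hx).1, ?_, ((hexp x hx).2.2 2).1, (hexp x hx).2.1.1⟩,
    p1, v1, T1, ?_, v3, T3, fun m hm => ⟨?_, ?_, T2 m hm⟩⟩
  · have h := ((hexp x hx).2.2 1).1
    simp only [pow_one] at h
    exact h
  · simpa only [pow_one] using p3
  · rw [p2 m hm, AMS.eval_one_iterate_euler_tailMoment_one hkn' hm]
  · rw [v2 m hm, AMS.eval_one_iterate_euler_tailMoment_two hkn' hm]
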